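/- Polytopes are convex hulls of finitely many points in a finite-dimensional real vector space. A polytope is simplicial if all its proper faces are simplices. For a simplicial polytope $P$ with vertex set $V$, the boundary complex $\Delta(P)$ is the simplicial complex on $V$ whose faces are the sets $F\subset V$ such that $F\neq V$ and the convex hull of $F$ is a face of $P$. A $d$-dimensional stacked polytope is a simplicial polytope obtained from a $d$-dimensional simplex by repeatedly (zero or more times) attaching a $d$-dimensional simplex to a facet; here attaching a $d$-simplex $S$ to a facet $F$ of a $d$-polytope $P$ means that $F$ is a facet of both $P$ and $S$, $P\cap S=F$, and $P\cup S$ is a $d$-dimensional simplicial polytope whose vertex set is the union of those of $P$ and $S$. For a simplicial complex $\Delta$ on a finite nonempty set $V$ and an integer $k\ge 0$, the $k$-th special graded Betti number is $$b_k(\Delta)=\sum_{W\subset V,\ |W|=k}\bigl(\mathrm{nc}(\Delta_W)-1\bigr),\qquad \Delta_W=\{F\cap W: F\in\Delta\},$$ where $\mathrm{nc}(\Delta_W)$ is the number of connected components of $\Delta_W$ as a complex on $W$ (so $\mathrm{nc}(\Delta_\emptyset)=0$). **Theorem.** Let $P$ be a $d$-dimensional stacked polytope with $n$ vertices and let $k\ge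 0$ be an integer. If $d\ge 3$, then $$b_k(\Delta(P))=(k-1)\binom{n-d}{k}.$$ If $d=2$, then $$b_k(\Delta(P))=\begin{cases}0,&\text{if }k=n,\\[2pt] \dfrac{n(k-1)}{n-k}\dbinom{n-2}{k},&\text{otherwise.}\end{cases}$$ -/

import Mathlib

open Set

section Polytopes

variable {E : Type*} [NormedAddCommGroup E] [NormedSpace ℝ E]

/-- A convex polytope: the convex hull of finitely many points. -/
def IsPolytope (P : Set E) : Prop :=
  ∃ S : Finset E, P = convexHull ℝ (S : Set E)

/-- The dimension of (the affine hull of) a nonempty convex set. -/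
noncomputable def polyDim (P : Set E) : ℕ :=
  Module.finrank ℝ (vectorSpan ℝ P)

/-- A face of a polytope: the empty set, or the set of points of `P` at which some linear
functional attains its maximum over `P` (the zero functional gives `P` itself). -/
def IsPolyFace (P F : Set E) : Prop :=
  IsExposed ℝ P F

/-- The vertex set of a polytope. -/
def polyVertices (P : Set E) : Set E :=
  P.extremePoints ℝ

/-- A facet of a `d`-dimensional polytope: a face of dimension `d - 1`. -/
def IsFacet (d : ℕ) (P F : Set E) : Prop :=
  IsPolyFace P F ∧ F.Nonempty ∧ polyDim F + 1 = d

/-- A geometric `d`-simplex: the convex hull of `d + 1` affinely independent points. -/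
def IsGeomSimplex (d : ℕ) (P : Set E) : Prop :=
  ∃ s : Affine.Simplex ℝ E d, P = convexHull ℝ (Set.range s.points)

/-- A `d`-dimensional simplicial polytope: all proper nonempty faces are simplices. -/
structure IsSimplicialPolytope (d : ℕ) (P : Set E) : Prop where
  isPolytope : IsPolytope P
  nonempty : P.Nonempty
  dim_eq : polyDim P = d
  face_simplex : ∀ F : Set E, IsPolyFace P F → F.Nonempty → F ≠ P → ∃ m : ℕ, IsGeomSimplex m F

/-- `Q` is a `d`-dimensional simplicial polytope obtained from the `d`-dimensional polytope `P` by
attaching a `d`-simplex `S` to a facet `F` of `P`: the union of `P` and `S`, which meet exactly in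
the common facet `F`, is a simplicial polytope whose vertices are those of `P` and of `S`. -/
def IsAttachment (d : ℕ) (P Q : Set E) : Prop :=
  ∃ S F : Set E, IsGeomSimplex d S ∧ IsFacet d P F ∧ IsFacet d S F ∧ P ∩ S = F ∧
    Q = P ∪ S ∧ IsSimplicialPolytope d Q ∧ polyVertices Q = polyVertices P ∪ polyVertices S

/-- A `d`-dimensional stacked polytope: obtained from a `d`-simplex by successively attaching
`d`-simplices to facets. -/
inductive IsStackedPolytope (d : ℕ) : Set E → Prop
  | simplex (P : Set E) : IsGeomSimplex d P → IsStackedPolytope d P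
  | attach (P Q : Set E) : IsStackedPolytope d P → IsAttachment d P Q → IsStackedPolytope d Q

/-- The boundary complex of a simplicial polytope `P` with vertex set `V`, as a collection of
subsets of `V`: those `F ⊆ V` with `F ≠ V` whose convex hull is a face of `P`. -/
def boundaryComplex (P : Set E) : Set (Set E) :=
  {F | F ⊆ polyVertices P ∧ F ≠ polyVertices P ∧ IsPolyFace P (convexHull ℝ F)}

end Polytopes

section Complexes

variable {α : Type*}

/-- The restriction `Δ_W = {F ∩ W : F ∈ Δ}`. -/
def restrictComplex (Δ : Set (Set α)) (W : Set α) : Set (Set α) :=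
  {G | ∃ F ∈ Δ, G = F ∩ W}

/-- `u` and `v` are connected in `Δ`: there is a sequence `u = u₀, u₁, …, u_r = v` with all
`{u_i, u_{i+1}} ∈ Δ`. -/
def ConnectedIn (Δ : Set (Set α)) (u v : α) : Prop :=
  Relation.ReflTransGen (fun a b => ({a, b} : Set α) ∈ Δ) u v

/-- A connected component of a complex `Δ` on `V`: a maximal nonempty subset of `V` any two
elements of which are connected in `Δ`. -/
def IsConnComponent (Δ : Set (Set α)) (V C : Set α) : Prop :=
  Maximal (fun D : Set α => D.Nonempty ∧ D ⊆ V ∧ ∀ u ∈ D, ∀ v ∈ D, ConnectedIn Δ u v) C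

/-- The number of connected components of a complex `Δ` on `V`. -/
noncomputable def numComponents (Δ : Set (Set α)) (V : Set α) : ℕ :=
  {C : Set α | IsConnComponent Δ V C}.ncard

/-- The `k`-th special graded Betti number of a complex `Δ` on a finite set `V`: the sum of
`nc(Δ_W) - 1` over all `W ⊆ V` with `|W| = k`. -/
noncomputable def specialBetti (Δ : Set (Set α)) (V : Finset α) (k : ℕ) : ℤ :=
  ∑ W ∈ V.powersetCard k,
    ((numComponents (restrictComplex Δ (W : Set α)) (W : Set α) : ℤ) - 1)

end Complexes

/-! Once there are at least three vertices, `nc(Δ_W)` depends only on the edge graph of `P` induced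
on `W`, so everything is about how that graph changes when a simplex with apex `v` is attached to a
facet with vertex set `F`.

The geometric input is convexity of `P ∪ S`: for a vertex `x` of `P` outside `F`, the segment from
`x` to `v` crosses conv `F` strictly between its ends. Hence a functional that is at most `c` on `F`
and equals `c` at one of `x`, `v` is at most `c` at the other, which carries supporting hyperplanes
over to the new polytope. It suffices to put two vertices on a common proper face, since proper
faces are simplices (`IsSimplicialPolytope.isEdge`). The neighbours of `v` turn out to be exactly
`F`.

If `d ≥ 3`, no old edge is lost and `F` is a clique. Adding `v` to `W` creates a component when `W`
misses `F` and changes nothing otherwise, so `graphBetti_insert` gives b_{k+1}(new) = b_{k+1} + b_k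
+ C(n-d, k). Pascal's rule shows that (k-1)C(n-d, k) obeys this recursion, starting from the
complete graph of the simplex.

If `d = 2`, the edge `F` disappears and is subdivided by `v`, so the graph stays a cycle. A proper
subset of a cycle has as many components as it has vertices whose successor is missing; double
counting gives b_k = n C(n-2, k-1) - C(n, k) for 1 ≤ k ≠ n. -/

/-! ### Component counts of graphs and their change under adding a vertex -/

section ComponentCount

variable {α β : Type*}

/-- `x` and `y` are joined by a path of the relation `R` inside `W`. -/
def GraphJoined (R : α → α → Prop) (W : Finset α) : α → α → Prop :=
  Relation.ReflTransGen (fun x y => x ∈ W ∧ y ∈ W ∧ R x y)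

/-- The number of connected components of the graph with adjacency relation `R` induced on `W`. -/
noncomputable def componentCount (R : α → α → Prop) (W : Finset α) : ℕ :=
  ((fun x => {y | GraphJoined R W x y}) '' (W : Set α)).ncard

theorem GraphJoined.symm {R : α → α → Prop} (hR : ∀ ⦃x y⦄, R x y → R y x) {W : Finset α} {x y : α}
    (h : GraphJoined R W x y) : GraphJoined R W y x :=
  (@Relation.ReflTransGen.stdSymm _ _ ⟨fun _ _ h => ⟨h.2.1, h.1, hR h.2.2⟩⟩).symm _ _ h

theorem ncard_image_eq_of_fiber_iff {γ : Type*} {W : Set α} {r : α → β} {s : α → γ}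
    (h : ∀ x ∈ W, ∀ y ∈ W, r x = r y ↔ s x = s y) : (r '' W).ncard = (s '' W).ncard := by
  refine Set.ncard_congr' ?_
  refine Equiv.ofBijective (fun z => ⟨s z.2.choose, _, z.2.choose_spec.1, rfl⟩) ⟨?_, ?_⟩
  · intro z w hzw
    have := congrArg Subtype.val hzw
    simp only at this
    rw [← h _ z.2.choose_spec.1 _ w.2.choose_spec.1] at this
    rw [z.2.choose_spec.2, w.2.choose_spec.2] at this
    exact Subtype.ext this
  · rintro ⟨_, x, hx, rfl⟩
    have hz : r x ∈ r '' W := ⟨x, hx, rfl⟩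
    exact ⟨⟨r x, hz⟩, Subtype.ext ((h _ hz.choose_spec.1 _ hx).1 hz.choose_spec.2)⟩

theorem setOf_joinedIn_eq_iff {R : α → α → Prop} (hR : ∀ ⦃x y⦄, R x y → R y x) {W : Finset α} {x y : α} :
    {z | GraphJoined R W x z} = {z | GraphJoined R W y z} ↔ GraphJoined R W x y := by
  constructor
  · intro h
    have : y ∈ {z | GraphJoined R W y z} := Relation.ReflTransGen.refl
    rw [← h] at this
    exact this
  · intro h
    ext z
    exact ⟨fun hz => (h.symm hR).trans hz, fun hz => h.trans hz⟩

/-- A labelling that is constant along edges and separates components counts the components. -/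
theorem componentCount_eq_ncard_image {R : α → α → Prop} (hR : ∀ ⦃x y⦄, R x y → R y x) {W : Finset α}
    (r : α → β) (h₁ : ∀ x ∈ W, ∀ y ∈ W, R x y → r x = r y)
    (h₂ : ∀ x ∈ W, ∀ y ∈ W, r x = r y → GraphJoined R W x y) :
    componentCount R W = (r '' (W : Set α)).ncard := by
  refine ncard_image_eq_of_fiber_iff fun x hx y hy => ?_
  rw [setOf_joinedIn_eq_iff hR]
  refine ⟨fun h => ?_, h₂ x hx y hy⟩
  induction h with
  | refl => rfl
  | tail _ h ih => exact (ih h.1).trans (h₁ _ h.1 _ h.2.1 h.2.2)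

theorem componentCount_congr {R R' : α → α → Prop} {W : Finset α}
    (h : ∀ x ∈ W, ∀ y ∈ W, R x y ↔ R' x y) : componentCount R W = componentCount R' W := by
  have : (fun x y => x ∈ W ∧ y ∈ W ∧ R x y) = fun x y => x ∈ W ∧ y ∈ W ∧ R' x y := by
    funext x y
    exact propext ⟨fun ⟨a, b, c⟩ => ⟨a, b, (h x a y b).1 c⟩, fun ⟨a, b, c⟩ => ⟨a, b, (h x a y b).2 c⟩⟩
  simp only [componentCount, GraphJoined, this]

@[simp] theorem componentCount_empty (R : α → α → Prop) : componentCount R ∅ = 0 := by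
  simp [componentCount]

/-- A labelling whose fibres are the connectivity classes makes `ConnectedIn` an equivalence on `W`,
so the maximal connected subsets are exactly these fibres. -/
theorem numComponents_eq_ncard_image {Δ : Set (Set α)} {W : Set α} (r : α → β)
    (hr : ∀ x ∈ W, ∀ y ∈ W, r x = r y ↔ ConnectedIn Δ x y) :
    numComponents Δ W = (r '' W).ncard := by
  have hcl : ∀ x ∈ W, IsConnComponent Δ W {y | y ∈ W ∧ r y = r x} := by
    intro x hx
    refine ⟨⟨⟨x, hx, rfl⟩, fun y hy => hy.1, fun u hu w hw =>
      (hr u hu.1 w hw.1).1 (hu.2.trans hw.2.symm)⟩, ?_⟩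
    rintro D ⟨-, hDW, hD⟩ hle y hy
    exact ⟨hDW hy, (hr y (hDW hy) x hx).2 (hD y hy x (hle ⟨hx, rfl⟩))⟩
  have : {C | IsConnComponent Δ W C} = (fun z => {y | y ∈ W ∧ r y = z}) '' (r '' W) := by
    ext C
    constructor
    · intro hC
      obtain ⟨⟨⟨x, hx⟩, hCW, hconn⟩, hmax⟩ := id hC
      refine ⟨r x, ⟨x, hCW hx, rfl⟩, ?_⟩
      have hle : C ≤ {y | y ∈ W ∧ r y = r x} := fun y hy =>
        ⟨hCW hy, (hr y (hCW hy) x (hCW hx)).2 (hconn y hy x hx)⟩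
      exact le_antisymm (hmax (hcl x (hCW hx)).1 hle) hle
    · rintro ⟨_, ⟨x, hx, rfl⟩, rfl⟩
      exact hcl x hx
  rw [numComponents, this, Set.InjOn.ncard_image]
  rintro _ ⟨x, hx, rfl⟩ w - h
  have : x ∈ {y | y ∈ W ∧ r y = r x} := ⟨hx, rfl⟩
  simp only at h
  rw [h] at this
  exact this.2

/-- Only pairs with `a ≠ b` matter: a degenerate pair `{a, a}` is a loop and does not affect
reachability. -/
theorem numComponents_eq_componentCount {Δ : Set (Set α)} {R : α → α → Prop} (hR : ∀ ⦃x y⦄, R x y → R y x)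
    {W : Finset α}
    (h : ∀ a b, a ≠ b → (({a, b} : Set α) ∈ Δ ↔ a ∈ W ∧ b ∈ W ∧ R a b)) :
    numComponents Δ W = componentCount R W := by
  refine numComponents_eq_ncard_image _ fun x hx y hy => ?_
  clear hx hy
  rw [setOf_joinedIn_eq_iff hR]
  constructor
  · intro hxy
    induction hxy with
    | refl => exact Relation.ReflTransGen.refl
    | @tail b c _ hbc ih =>
      by_cases hne : b = c
      · exact hne ▸ ih
      · exact ih.tail ((h b c hne).2 hbc)
  · intro hxy
    induction hxy with
    | refl => exact Relation.ReflTransGen.refl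
    | @tail b c _ hbc ih =>
      by_cases hne : b = c
      · exact hne ▸ ih
      · exact ih.tail ((h b c hne).1 hbc)

/-- The special graded Betti number in terms of the graph alone. -/
noncomputable def graphBetti (R : α → α → Prop) (V : Finset α) (k : ℕ) : ℤ :=
  ∑ W ∈ V.powersetCard k, ((componentCount R W : ℤ) - 1)

@[simp] theorem graphBetti_zero (R : α → α → Prop) (V : Finset α) : graphBetti R V 0 = -1 := by
  simp [graphBetti]

theorem graphBetti_congr {R R' : α → α → Prop} {V : Finset α}
    (h : ∀ x ∈ V, ∀ y ∈ V, R x y ↔ R' x y) (k : ℕ) : graphBetti R V k = graphBetti R' V k := by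
  refine Finset.sum_congr rfl fun W hW => ?_
  have hWV := (Finset.mem_powersetCard.1 hW).1
  rw [componentCount_congr fun x hx y hy => h x (hWV hx) y (hWV hy)]

theorem GraphJoined.mono {R : α → α → Prop} {W W' : Finset α} (hW : W ⊆ W') {x y : α}
    (h : GraphJoined R W x y) : GraphJoined R W' x y :=
  Relation.ReflTransGen.mono (fun _ _ h => ⟨hW h.1, hW h.2.1, h.2.2⟩) _ _ h

theorem componentCount_of_clique {R : α → α → Prop} (hR : ∀ ⦃x y⦄, R x y → R y x) {W : Finset α}
    (hW : W.Nonempty) (h : ∀ x ∈ W, ∀ y ∈ W, x ≠ y → R x y) : componentCount R W = 1 := by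
  rw [componentCount_eq_ncard_image hR (fun _ => ()) (fun _ _ _ _ _ => rfl)]
  · rw [Set.Nonempty.image_const (by exact_mod_cast hW), Set.ncard_singleton]
  · intro x hx y hy _
    by_cases hxy : x = y
    · exact hxy ▸ Relation.ReflTransGen.refl
    · exact Relation.ReflTransGen.single ⟨hx, hy, h x hx y hy hxy⟩

variable [DecidableEq α]

theorem componentCount_insert_of_isolated {R : α → α → Prop} (hR : ∀ ⦃x y⦄, R x y → R y x) {W : Finset α}
    {v : α} (hv : v ∉ W) (hiso : ∀ x ∈ W, ¬ R x v) :
    componentCount R (insert v W) = componentCount R W + 1 := by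
  -- The label `none` is reserved for the new component `{v}`.
  let r : α → Option (Set α) := fun x => if x = v then none else some {y | GraphJoined R W x y}
  have hrW : ∀ x ∈ W, r x = some {y | GraphJoined R W x y} := fun x hx =>
    if_neg (fun h : x = v => hv (h ▸ hx))
  have hrv : r v = none := if_pos rfl
  rw [componentCount_eq_ncard_image hR r]
  · rw [Finset.coe_insert, Set.image_insert_eq, Set.ncard_insert_of_notMem]
    · congr 1
      refine ncard_image_eq_of_fiber_iff fun x hx y hy => ?_
      rw [hrW x hx, hrW y hy, Option.some_inj]
    · rintro ⟨x, hx, h⟩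
      rw [hrW x hx, hrv] at h
      cases h
  · intro x hx y hy hxy
    rcases Finset.mem_insert.1 hx with rfl | hx'
    · rcases Finset.mem_insert.1 hy with rfl | hy
      · rfl
      · exact absurd (hR hxy) (hiso y hy)
    · replace hx := hx'
      rcases Finset.mem_insert.1 hy with rfl | hy
      · exact absurd hxy (hiso x hx)
      · rw [hrW x hx, hrW y hy, Option.some_inj, setOf_joinedIn_eq_iff hR]
        exact Relation.ReflTransGen.single ⟨hx, hy, hxy⟩
  · intro x hx y hy hxy
    rcases Finset.mem_insert.1 hx with rfl | hx'
    · rcases Finset.mem_insert.1 hy with rfl | hy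
      · exact Relation.ReflTransGen.refl
      · rw [hrv, hrW y hy] at hxy
        cases hxy
    · replace hx := hx'
      rcases Finset.mem_insert.1 hy with rfl | hy
      · rw [hrv, hrW x hx] at hxy
        cases hxy
      · rw [hrW x hx, hrW y hy, Option.some_inj, setOf_joinedIn_eq_iff hR] at hxy
        exact hxy.mono (Finset.subset_insert v W)

/-- Every neighbour of `v` in `W` is `w` or adjacent to `w`, so `v` joins the component of `w`
without merging any two old ones. -/
theorem componentCount_insert_of_clique {R : α → α → Prop} (hR : ∀ ⦃x y⦄, R x y → R y x) {W : Finset α}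
    {v w : α} (hv : v ∉ W) (hw : w ∈ W) (hvw : R v w)
    (hcl : ∀ x ∈ W, R x v → x ≠ w → R x w) :
    componentCount R (insert v W) = componentCount R W := by
  let r : α → Set α := fun x => if x = v then {y | GraphJoined R W w y} else {y | GraphJoined R W x y}
  have hrW : ∀ x ∈ W, r x = {y | GraphJoined R W x y} := fun x hx =>
    if_neg (fun h : x = v => hv (h ▸ hx))
  have hrv : r v = {y | GraphJoined R W w y} := if_pos rfl
  have hjoin : GraphJoined R (insert v W) v w := Relation.ReflTransGen.single
    ⟨Finset.mem_insert_self v W, Finset.mem_insert_of_mem hw, hvw⟩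
  have hadj : ∀ x ∈ W, R x v → GraphJoined R W x w := fun x hx hxv => by
    by_cases hxw : x = w
    · exact hxw ▸ Relation.ReflTransGen.refl
    · exact Relation.ReflTransGen.single ⟨hx, hw, hcl x hx hxv hxw⟩
  rw [componentCount_eq_ncard_image hR r]
  · rw [Finset.coe_insert, Set.image_insert_eq, Set.insert_eq_of_mem]
    · refine ncard_image_eq_of_fiber_iff fun x hx y hy => ?_
      rw [hrW x hx, hrW y hy]
    · exact ⟨w, hw, by rw [hrW w hw, hrv]⟩
  · intro x hx y hy hxy
    rcases Finset.mem_insert.1 hx with rfl | hx'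
    · rcases Finset.mem_insert.1 hy with rfl | hy
      · rfl
      · rw [hrv, hrW y hy, setOf_joinedIn_eq_iff hR]
        exact (hadj y hy (hR hxy)).symm hR
    · replace hx := hx'
      rcases Finset.mem_insert.1 hy with rfl | hy
      · rw [hrv, hrW x hx, setOf_joinedIn_eq_iff hR]
        exact hadj x hx hxy
      · rw [hrW x hx, hrW y hy, setOf_joinedIn_eq_iff hR]
        exact Relation.ReflTransGen.single ⟨hx, hy, hxy⟩
  · intro x hx y hy hxy
    rcases Finset.mem_insert.1 hx with rfl | hx'
    · rcases Finset.mem_insert.1 hy with rfl | hy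
      · exact Relation.ReflTransGen.refl
      · rw [hrv, hrW y hy, setOf_joinedIn_eq_iff hR] at hxy
        exact hjoin.trans (hxy.mono (Finset.subset_insert _ W))
    · replace hx := hx'
      rcases Finset.mem_insert.1 hy with rfl | hy
      · rw [hrv, hrW x hx, setOf_joinedIn_eq_iff hR] at hxy
        exact (hxy.mono (Finset.subset_insert _ W)).trans (hjoin.symm hR)
      · rw [hrW x hx, hrW y hy, setOf_joinedIn_eq_iff hR] at hxy
        exact hxy.mono (Finset.subset_insert v W)

/-- Adding a vertex `v` whose neighbours form the clique `F`. -/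
theorem graphBetti_insert {R : α → α → Prop} (hR : ∀ ⦃x y⦄, R x y → R y x) {V F : Finset α} {v : α}
    (hv : v ∉ V) (hF : F ⊆ V) (hcl : ∀ x ∈ F, ∀ y ∈ F, x ≠ y → R x y)
    (hadj : ∀ x ∈ V, R x v ↔ x ∈ F) (k : ℕ) :
    graphBetti R (insert v V) (k + 1) =
      graphBetti R V (k + 1) + graphBetti R V k + ((V.card - F.card).choose k : ℤ) := by
  -- The new summands come from the sets `insert v W`: `v` is isolated when `W` avoids `F`, and
  -- otherwise it attaches to the one component of `W` that meets the clique `F`.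
  have hcount : ∀ W ∈ V.powersetCard k, ((componentCount R (insert v W) : ℤ) - 1) =
      ((componentCount R W : ℤ) - 1) + if W ⊆ V \ F then 1 else 0 := by
    intro W hW
    have hWV := (Finset.mem_powersetCard.1 hW).1
    split_ifs with h
    · rw [componentCount_insert_of_isolated hR (fun h => hv (hWV h))
        (fun x hx hxv => (Finset.mem_sdiff.1 (h hx)).2 ((hadj x (hWV hx)).1 hxv))]
      push_cast
      ring
    · obtain ⟨w, hwW, hw⟩ := Finset.not_subset.1 h
      have hwF : w ∈ F := by
        by_contra hc
        exact hw (Finset.mem_sdiff.2 ⟨hWV hwW, hc⟩)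
      rw [componentCount_insert_of_clique hR (fun h => hv (hWV h)) hwW
        (hR ((hadj w (hF hwF)).2 hwF))
        (fun x hx hxv hxw => hcl x ((hadj x (hWV hx)).1 hxv) w hwF hxw), add_zero]
  rw [graphBetti, Finset.powersetCard_succ_insert hv, Finset.sum_union, Finset.sum_image,
    Finset.sum_congr rfl hcount, Finset.sum_add_distrib, Finset.sum_boole]
  · rw [graphBetti, graphBetti, add_assoc]
    congr 3
    have : (V.powersetCard k).filter (fun W => W ⊆ V \ F) = (V \ F).powersetCard k := by
      ext W
      simp only [Finset.mem_filter, Finset.mem_powersetCard]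
      exact ⟨fun h => ⟨h.2, h.1.2⟩, fun h => ⟨⟨h.1.trans Finset.sdiff_subset, h.2⟩, h.1⟩⟩
    rw [this, Finset.card_powersetCard, Finset.card_sdiff_of_subset hF]
  · intro W hW W' hW' h
    have h1 : v ∉ W := fun h => hv ((Finset.mem_powersetCard.1 hW).1 h)
    have h2 : v ∉ W' := fun h => hv ((Finset.mem_powersetCard.1 hW').1 h)
    rw [← Finset.erase_insert h1, ← Finset.erase_insert h2]
    exact congrArg (fun X => X.erase v) h
  · rw [Finset.disjoint_left]
    intro W hW hW'
    obtain ⟨W₀, -, rfl⟩ := Finset.mem_image.1 hW'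
    exact hv ((Finset.mem_powersetCard.1 hW).1 (Finset.mem_insert_self v W₀))

end ComponentCount

/-! ### Cycle graphs and their Betti numbers -/

section Cycle

variable {α : Type*}

/-- The graph with adjacency relation `R` on `V` is a cycle with successor map `σ`. -/
structure IsCycleGraph (R : α → α → Prop) (V : Finset α) (σ : α → α) : Prop where
  mapsTo : ∀ x ∈ V, σ x ∈ V
  ne : ∀ x ∈ V, σ x ≠ x
  ne_ne : ∀ x ∈ V, σ (σ x) ≠ x
  adj_iff : ∀ x ∈ V, ∀ y ∈ V, R x y ↔ y = σ x ∨ x = σ y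
  -- This excludes disjoint unions of several cycles.
  transitive : ∀ A : Set α, A ⊆ V → A.Nonempty → (∀ x ∈ A, σ x ∈ A) → A = V

/-- The edge from `a` to `σ a` is subdivided: the new successor map runs `a`, `v`, `σ a` and agrees
with `σ` elsewhere. -/
theorem IsCycleGraph.insert_vertex [DecidableEq α] {R R' : α → α → Prop} (hR' : ∀ ⦃x y⦄, R' x y → R' y x)
    (hirr : ∀ x, ¬ R' x x) {V : Finset α}
    {σ : α → α} (h : IsCycleGraph R V σ) {a v : α} (ha : a ∈ V) (hv : v ∉ V)
    (hV : ∀ x ∈ V, ∀ y ∈ V, R' x y ↔ R x y ∧ ¬ (x = a ∧ y = σ a) ∧ ¬ (x = σ a ∧ y = a))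
    (hadj : ∀ x ∈ V, R' x v ↔ x = a ∨ x = σ a) :
    IsCycleGraph R' (insert v V) (fun x => if x = a then v else if x = v then σ a else σ x) := by
  have hva : v ≠ a := fun h => hv (h ▸ ha)
  have hb := h.mapsTo a ha
  have hvb : v ≠ σ a := fun h => hv (h ▸ hb)
  have hne : ∀ x ∈ V, x ≠ v := fun x hx h => hv (h ▸ hx)
  have hba := h.ne a ha
  set τ : α → α := fun x => if x = a then v else if x = v then σ a else σ x with hτ
  have hτa : τ a = v := by simp [hτ]
  have hτv : τ v = σ a := by simp [hτ, hva]
  have hτx : ∀ x ∈ V, x ≠ a → τ x = σ x := fun x hx hxa => by simp [hτ, hxa, hne x hx]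
  refine ⟨?_, ?_, ?_, ?_, ?_⟩
  · intro x hx
    rcases Finset.mem_insert.1 hx with rfl | hx
    · rw [hτv]; exact Finset.mem_insert_of_mem hb
    · by_cases hxa : x = a
      · rw [hxa, hτa]; exact Finset.mem_insert_self _ _
      · rw [hτx x hx hxa]; exact Finset.mem_insert_of_mem (h.mapsTo x hx)
  · intro x hx
    rcases Finset.mem_insert.1 hx with rfl | hx
    · rw [hτv]; exact hvb.symm
    · by_cases hxa : x = a
      · rw [hxa, hτa]; exact hva
      · rw [hτx x hx hxa]; exact h.ne x hx
  · intro x hx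
    rcases Finset.mem_insert.1 hx with rfl | hx
    · rw [hτv, hτx _ hb hba]
      exact hne _ (h.mapsTo _ hb)
    · by_cases hxa : x = a
      · rw [hxa, hτa, hτv]; exact hba
      · rw [hτx x hx hxa]
        by_cases hs : σ x = a
        · rw [hs, hτa]; exact (hne x hx).symm
        · rw [hτx _ (h.mapsTo x hx) hs]; exact h.ne_ne x hx
  · have key : ∀ x ∈ V, R' x v ↔ v = τ x ∨ x = τ v := by
      intro x hx
      rw [hadj x hx, hτv]
      by_cases hxa : x = a
      · simp [hxa, hτa]
      · rw [hτx x hx hxa]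
        simp [hxa, (hne _ (h.mapsTo x hx)).symm]
    intro x hx y hy
    rcases Finset.mem_insert.1 hx with rfl | hx'
    · rcases Finset.mem_insert.1 hy with rfl | hy
      · simp [hirr, hτv, hvb]
      · rw [or_comm, ← key y hy]
        exact ⟨fun h => hR' h, fun h => hR' h⟩
    · replace hx := hx'
      rcases Finset.mem_insert.1 hy with rfl | hy
      · exact key x hx
      · rw [hV x hx y hy, h.adj_iff x hx y hy]
        -- Since there is no 2-cycle, the deleted edge arises in one orientation only and no
        -- surviving arc coincides with it.
        have haa := h.ne_ne a ha
        by_cases hxa : x = a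
        · subst hxa
          by_cases hya : y = x
          · subst hya
            simp [hτa, hva.symm, hba.symm]
          · rw [hτa, hτx y hy hya]
            have := hne y hy
            constructor
            · rintro ⟨h1 | h1, h2, h3⟩
              · exact absurd ⟨rfl, h1⟩ h2
              · exact Or.inr h1
            · rintro (h1 | h1)
              · exact absurd h1 this
              · refine ⟨Or.inr h1, fun h2 => ?_, fun h2 => hya h2.2⟩
                rw [h2.2] at h1
                exact haa h1.symm
        · by_cases hya : y = a
          · subst hya
            rw [hτa, hτx x hx hxa]
            constructor
            · rintro ⟨h1 | h1, h2, h3⟩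
              · exact Or.inl h1
              · exact absurd ⟨h1, rfl⟩ h3
            · rintro (h1 | h1)
              · refine ⟨Or.inl h1, fun h2 => hxa h2.1, fun h2 => ?_⟩
                rw [h2.1] at h1
                exact haa h1.symm
              · exact absurd h1 (hne x hx)
          · rw [hτx x hx hxa, hτx y hy hya]
            simp [hxa, hya]
  · intro A hA hne' hcl
    have hbA : ∀ x ∈ A, x = a → σ a ∈ A := fun x hx hxa => by
      have := hcl _ (hcl x hx)
      rwa [hxa, hτa, hτv] at this
    have hAV : A ∩ V = V := by
      refine h.transitive _ Set.inter_subset_right ?_ ?_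
      · obtain ⟨x, hx⟩ := hne'
        rcases Finset.mem_insert.1 (hA hx) with rfl | hxV
        · exact ⟨σ a, hτv ▸ hcl _ hx, hb⟩
        · exact ⟨x, hx, hxV⟩
      · rintro x ⟨hx, hxV⟩
        refine ⟨?_, h.mapsTo x hxV⟩
        by_cases hxa : x = a
        · rw [hxa]; exact hbA x hx hxa
        · rw [← hτx x hxV hxa]; exact hcl x hx
    have hVA : (V : Set α) ⊆ A := fun x hx => (hAV.ge hx).1
    refine Set.Subset.antisymm hA fun x hx => ?_
    rcases Finset.mem_insert.1 hx with rfl | hx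
    · exact hτa ▸ hcl a (hVA ha)
    · exact hVA hx

theorem IsCycleGraph.componentCount_self {R : α → α → Prop} (hR : ∀ ⦃x y⦄, R x y → R y x) {V : Finset α}
    {σ : α → α} (h : IsCycleGraph R V σ) (hV : V.Nonempty) : componentCount R V = 1 := by
  rw [componentCount_eq_ncard_image hR (fun _ => ()) (fun _ _ _ _ _ => rfl)]
  · rw [Set.Nonempty.image_const (by exact_mod_cast hV), Set.ncard_singleton]
  · intro x hx y hy _
    have := h.transitive {y | y ∈ V ∧ GraphJoined R V x y} (fun y hy => hy.1)
      ⟨x, hx, Relation.ReflTransGen.refl⟩ (fun y hy => ⟨h.mapsTo y hy.1, hy.2.tail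
        ⟨hy.1, h.mapsTo y hy.1, (h.adj_iff y hy.1 _ (h.mapsTo y hy.1)).2 (Or.inl rfl)⟩⟩)
    exact (this.ge (show y ∈ (V : Set α) from hy)).2

open Classical in
-- A proper subset of a cycle breaks into arcs, and each arc is labelled by its last vertex, the one
-- whose successor is missing.
theorem IsCycleGraph.componentCount_of_ssubset {R : α → α → Prop} (hR : ∀ ⦃x y⦄, R x y → R y x)
    {V W : Finset α} {σ : α → α} (h : IsCycleGraph R V σ) (hWV : W ⊂ V) :
    componentCount R W = (W.filter (fun x => σ x ∉ W)).card := by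
  -- A forward orbit that never left `W` would be `σ`-closed, hence all of `V`.
  have hex : ∀ x ∈ W, ∃ m, σ^[m + 1] x ∉ W := by
    intro x hx
    by_contra! hc
    have hall : ∀ m, σ^[m] x ∈ W := fun m => by
      cases m with
      | zero => exact hx
      | succ m => exact hc m
    have := h.transitive {y | ∃ m, σ^[m] x = y}
      (by rintro _ ⟨m, rfl⟩; exact hWV.1 (hall m)) ⟨x, 0, rfl⟩
      (by rintro _ ⟨m, rfl⟩; exact ⟨m + 1, Function.iterate_succ_apply' σ m x⟩)
    refine hWV.2 fun y hy => ?_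
    obtain ⟨m, rfl⟩ := this.ge (show y ∈ (V : Set α) from hy)
    exact hall m
  -- `N x` counts the steps from `x` to the end of its arc; the default 0 is never taken on `W`.
  let N : α → ℕ := fun x => if hx : ∃ m, σ^[m + 1] x ∉ W then Nat.find hx else 0
  let r : α → α := fun x => σ^[N x] x
  have hN : ∀ x ∈ W, σ^[N x + 1] x ∉ W := fun x hx => by
    simp only [N, dif_pos (hex x hx)]
    exact Nat.find_spec (hex x hx)
  have hN' : ∀ x ∈ W, ∀ m < N x, σ^[m + 1] x ∈ W := fun x hx m hm => by
    simp only [N, dif_pos (hex x hx)] at hm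
    exact not_not.1 (Nat.find_min (hex x hx) hm)
  have hmem : ∀ x ∈ W, ∀ m ≤ N x, σ^[m] x ∈ W := fun x hx m hm => by
    cases m with
    | zero => exact hx
    | succ m => exact hN' x hx m hm
  have hjoin : ∀ x ∈ W, ∀ m ≤ N x, GraphJoined R W x (σ^[m] x) := fun x hx m hm => by
    induction m with
    | zero => exact Relation.ReflTransGen.refl
    | succ m ih =>
      have h1 := hmem x hx m (by omega)
      have h2 := hmem x hx (m + 1) hm
      refine (ih (by omega)).tail ⟨h1, h2, (h.adj_iff _ (hWV.1 h1) _ (hWV.1 h2)).2 (Or.inl ?_)⟩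
      exact Function.iterate_succ_apply' σ m x
  have hstep : ∀ x ∈ W, σ x ∈ W → r x = r (σ x) := by
    intro x hx hsx
    have hpos : N x ≠ 0 := fun h0 => by
      have := hN x hx
      rw [h0] at this
      exact this hsx
    obtain ⟨m, hm⟩ := Nat.exists_eq_succ_of_ne_zero hpos
    have : N (σ x) = m := by
      apply le_antisymm
      · by_contra! hlt
        have h1 := hN' (σ x) hsx m hlt
        have h2 := hN x hx
        rw [hm] at h2
        exact h2 h1
      · by_contra! hlt
        have h1 := hN (σ x) hsx
        have h2 := hN' x hx (N (σ x) + 1) (by omega)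
        exact h1 h2
    simp only [r, this, hm]
    exact Function.iterate_succ_apply σ m x
  have hrjoin : ∀ x ∈ W, GraphJoined R W x (r x) := fun x hx => hjoin x hx _ le_rfl
  rw [componentCount_eq_ncard_image hR r]
  · rw [← Set.ncard_coe_finset]
    congr 1
    ext y
    simp only [Set.mem_image, Finset.coe_filter, Set.mem_ofPred_eq, Finset.mem_coe]
    constructor
    · rintro ⟨x, hx, rfl⟩
      refine ⟨hmem x hx _ le_rfl, ?_⟩
      have := hN x hx
      rwa [Function.iterate_succ_apply'] at this
    · rintro ⟨hy, hsy⟩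
      refine ⟨y, hy, ?_⟩
      have : N y = 0 := by
        by_contra h0
        exact hsy (hN' y hy 0 (Nat.pos_of_ne_zero h0))
      simp [r, this]
  · intro x hx y hy hxy
    rcases (h.adj_iff x (hWV.1 hx) y (hWV.1 hy)).1 hxy with rfl | rfl
    · exact hstep x hx hy
    · exact (hstep y hy hx).symm
  · intro x hx y hy hxy
    exact (hrjoin x hx).trans (hxy ▸ (hrjoin y hy).symm hR)

open Classical in
-- Such a `W` consists of `x` and a free choice of `k` among the vertices other than `x` and `y`.
theorem card_powersetCard_filter_mem_notMem {V : Finset α} {x y : α} (hx : x ∈ V) (hy : y ∈ V)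
    (hxy : y ≠ x) (k : ℕ) :
    ((V.powersetCard (k + 1)).filter (fun W => x ∈ W ∧ y ∉ W)).card = (V.card - 2).choose k := by
  have hcard : ((V.erase x).erase y).card = V.card - 2 := by
    rw [Finset.card_erase_of_mem (Finset.mem_erase.2 ⟨hxy, hy⟩), Finset.card_erase_of_mem hx]
    omega
  rw [← hcard, ← Finset.card_powersetCard]
  refine Finset.card_bij' (fun W _ => W.erase x) (fun W _ => insert x W) ?_ ?_ ?_ ?_
  · intro W hW
    simp only [Finset.mem_filter, Finset.mem_powersetCard] at hW ⊢
    refine ⟨fun z hz => ?_, by rw [Finset.card_erase_of_mem hW.2.1, hW.1.2]; rfl⟩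
    have hz' := Finset.mem_erase.1 hz
    exact Finset.mem_erase.2 ⟨fun h => hW.2.2 (h ▸ hz'.2), Finset.mem_erase.2 ⟨hz'.1, hW.1.1 hz'.2⟩⟩
  · intro W hW
    simp only [Finset.mem_filter, Finset.mem_powersetCard] at hW ⊢
    have hxW : x ∉ W := fun h => by simpa using hW.1 h
    have hyW : y ∉ W := fun h => by simpa using hW.1 h
    refine ⟨⟨fun z hz => ?_, by rw [Finset.card_insert_of_notMem hxW, hW.2]⟩,
      Finset.mem_insert_self _ _, fun h => ?_⟩
    · rcases Finset.mem_insert.1 hz with rfl | hz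
      · exact hx
      · exact Finset.mem_of_mem_erase (Finset.mem_of_mem_erase (hW.1 hz))
    · rcases Finset.mem_insert.1 h with h | h
      · exact hxy h
      · exact hyW h
  · intro W hW
    exact Finset.insert_erase (Finset.mem_filter.1 hW).2.1
  · intro W hW
    exact Finset.erase_insert fun h => by simpa using (Finset.mem_powersetCard.1 hW).1 h

/-- Double counting of the pairs `(W, x)` with `x ∈ W` and `σ x ∉ W`. The case `W = V` is excluded
because the full cycle has one component but no such `x`. -/
theorem IsCycleGraph.graphBetti_succ {R : α → α → Prop} (hR : ∀ ⦃x y⦄, R x y → R y x)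
    {V : Finset α} {σ : α → α} (h : IsCycleGraph R V σ) {k : ℕ} (hk : k + 1 ≠ V.card) :
    graphBetti R V (k + 1) =
      (V.card : ℤ) * ((V.card - 2).choose k : ℤ) - (V.card.choose (k + 1) : ℤ) := by
  classical
  rw [graphBetti, Finset.sum_sub_distrib]
  congr 1
  · have h1 : ∀ W ∈ V.powersetCard (k + 1), (componentCount R W : ℤ) =
        ∑ x ∈ V, if x ∈ W ∧ σ x ∉ W then 1 else 0 := by
      intro W hW
      obtain ⟨hWV, hWc⟩ := Finset.mem_powersetCard.1 hW
      have hss : W ⊂ V := hWV.ssubset_of_ne fun he => hk (by rw [← hWc, he])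
      rw [h.componentCount_of_ssubset hR hss, Finset.sum_boole]
      congr 2
      ext x
      simp only [Finset.mem_filter]
      exact ⟨fun hx => ⟨hWV hx.1, hx⟩, fun hx => hx.2⟩
    rw [Finset.sum_congr rfl h1, Finset.sum_comm]
    have h2 : ∀ x ∈ V, (∑ W ∈ V.powersetCard (k + 1), if x ∈ W ∧ σ x ∉ W then (1 : ℤ) else 0) =
        ((V.card - 2).choose k : ℤ) := fun x hx => by
      rw [Finset.sum_boole,
        card_powersetCard_filter_mem_notMem hx (h.mapsTo x hx) (h.ne x hx)]
    rw [Finset.sum_congr rfl h2, Finset.sum_const, nsmul_eq_mul]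
  · simp

/-- Here `n = m + 2` and `k = j + 1`, so `hj` says `k ≠ n`. For `j > m` all three binomials vanish;
otherwise each is a rational multiple of C(m, j). -/
theorem cycle_betti_formula {m j : ℕ} (hj : j ≠ m + 1) :
    ((m + 2 : ℕ) : ℚ) * (m.choose j : ℚ) - ((m + 2).choose (j + 1) : ℚ) =
      ((m + 2 : ℕ) : ℚ) * (((j + 1 : ℕ) : ℚ) - 1) / (((m + 2 : ℕ) : ℚ) - ((j + 1 : ℕ) : ℚ)) *
        (m.choose (j + 1) : ℚ) := by
  rcases Nat.lt_or_ge m j with hlt | hle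
  · rw [Nat.choose_eq_zero_of_lt hlt, Nat.choose_eq_zero_of_lt (by omega : m + 2 < j + 1),
      Nat.choose_eq_zero_of_lt (by omega : m < j + 1)]
    simp
  · obtain ⟨i, rfl⟩ := Nat.exists_eq_add_of_le hle
    have e1 : ((j + i).choose (j + 1) : ℚ) * (j + 1) = (j + i).choose j * i := by
      have := Nat.choose_succ_right_eq (j + i) j
      rw [Nat.add_sub_cancel_left] at this
      exact_mod_cast this
    have e2 : ((j + i + 2 : ℕ) : ℚ) * ((j + i + 1).choose j : ℚ) =
        ((j + i + 2).choose (j + 1) : ℚ) * (j + 1) := by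
      exact_mod_cast Nat.add_one_mul_choose_eq (j + i + 1) j
    have e3 : ((j + i).choose j : ℚ) * (j + i + 1) = ((j + i + 1).choose j : ℚ) * (i + 1) := by
      have := Nat.choose_mul_succ_eq (j + i) j
      rw [show j + i + 1 - j = i + 1 by omega] at this
      exact_mod_cast this
    have hi : ((i : ℚ) + 1) ≠ 0 := by positivity
    have hj' : ((j : ℚ) + 1) ≠ 0 := by positivity
    have hden : ((j + i + 2 : ℕ) : ℚ) - ((j + 1 : ℕ) : ℚ) = i + 1 := by push_cast; ring
    rw [hden]
    push_cast at *
    rw [← sub_eq_zero]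
    have : ((j + i + 2).choose (j + 1) : ℚ) =
        (j + i + 2) * ((j + i).choose j * (j + i + 1)) / ((i + 1) * (j + 1)) := by
      rw [eq_div_iff (mul_ne_zero hi hj'), e3]
      linear_combination (-(i + 1 : ℚ)) * e2
    rw [this]
    have h4 : ((j + i).choose (j + 1) : ℚ) = (j + i).choose j * i / (j + 1) := by
      rw [eq_div_iff hj', e1]
    rw [h4]
    field_simp
    ring

theorem IsCycleGraph.graphBetti_eq {R : α → α → Prop} (hR : ∀ ⦃x y⦄, R x y → R y x)
    {V : Finset α} {σ : α → α} (h : IsCycleGraph R V σ) (h2 : 2 ≤ V.card) (k : ℕ) :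
    (k = V.card → graphBetti R V k = 0) ∧
      (k ≠ V.card → (graphBetti R V k : ℚ) =
        (V.card : ℚ) * ((k : ℚ) - 1) / ((V.card : ℚ) - (k : ℚ)) * ((V.card - 2).choose k : ℚ)) := by
  constructor
  · rintro rfl
    have hne : V.Nonempty := Finset.card_pos.1 (by omega)
    simp [graphBetti, h.componentCount_self hR hne]
  · intro hk
    obtain ⟨m, hm⟩ := Nat.exists_eq_add_of_le h2
    rw [add_comm] at hm
    cases k with
    -- Both sides are -1, the left one because the empty complex has no components.
    | zero =>
      have : (V.card : ℚ) ≠ 0 := by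
        rw [hm]; positivity
      simp only [graphBetti_zero, Nat.choose_zero_right]
      push_cast
      field_simp
      ring
    | succ j =>
      rw [h.graphBetti_succ hR hk, hm, Nat.add_sub_cancel]
      rw [← cycle_betti_formula (by omega)]
      push_cast
      ring

end Cycle

/-! ### Supporting hyperplanes, faces and simplices -/

section Geometry

variable {E : Type*} [NormedAddCommGroup E] [NormedSpace ℝ E]

/-- `a` and `b` span an edge of the convex hull of `V`: some functional attains its maximum over
`V` exactly at `a` and `b`. -/
def IsEdge (V : Finset E) (a b : E) : Prop :=
  a ≠ b ∧ ∃ l : E →L[ℝ] ℝ, l a = l b ∧ ∀ x ∈ V, x ≠ a → x ≠ b → l x < l a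

theorem IsEdge.symm {V : Finset E} ⦃a b : E⦄ (h : IsEdge V a b) : IsEdge V b a := by
  obtain ⟨hab, l, hl, h⟩ := h
  exact ⟨hab.symm, l, hl.symm, fun x hx h1 h2 => hl ▸ h x hx h2 h1⟩

theorem le_of_mem_convexHull {V : Set E} {l : E →L[ℝ] ℝ} {c : ℝ} (h : ∀ x ∈ V, l x ≤ c)
    {x : E} (hx : x ∈ convexHull ℝ V) : l x ≤ c := by
  have : Convex ℝ {x | l x ≤ c} := convex_halfSpace_le l.toLinearMap.isLinear c
  exact convexHull_min h this hx

theorem eq_of_mem_convexHull {V : Set E} {l : E →L[ℝ] ℝ} {c : ℝ} (h : ∀ x ∈ V, l x = c)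
    {x : E} (hx : x ∈ convexHull ℝ V) : l x = c := by
  have : Convex ℝ {x | l x = c} := convex_hyperplane l.toLinearMap.isLinear c
  exact convexHull_min h this hx

/-- The part of a polytope on a supporting hyperplane is spanned by the generators on it. -/
theorem convexHull_inter_hyperplane {V : Finset E} {l : E →L[ℝ] ℝ} {c : ℝ}
    (h : ∀ x ∈ V, l x ≤ c) :
    {x ∈ convexHull ℝ (V : Set E) | l x = c} = convexHull ℝ {x | x ∈ V ∧ l x = c} := by
  classical
  apply Set.Subset.antisymm
  · rintro x ⟨hx, hlx⟩
    obtain ⟨w, hw0, hw1, hwx⟩ := Finset.mem_convexHull'.1 hx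
    -- The weighted mean of the nonnegative gaps `c - l y` is zero, so the weights live on the
    -- hyperplane.
    have hsum : ∑ y ∈ V, w y * (c - l y) = 0 := by
      have : l x = ∑ y ∈ V, w y * l y := by
        rw [← hwx, map_sum]
        simp
      simp only [mul_sub, Finset.sum_sub_distrib]
      rw [← Finset.sum_mul, hw1, ← this, hlx]
      ring
    have hz := (Finset.sum_eq_zero_iff_of_nonneg
      (fun y hy => mul_nonneg (hw0 y hy) (sub_nonneg.2 (h y hy)))).1 hsum
    have hz' : ∀ y ∈ V, w y ≠ 0 → l y = c := fun y hy hwy => by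
      have := (mul_eq_zero.1 (hz y hy)).resolve_left hwy
      linarith
    have hcoe : {x | x ∈ V ∧ l x = c} = ((V.filter (fun x => l x = c) : Finset E) : Set E) := by
      ext; simp
    rw [hcoe, Finset.mem_convexHull']
    refine ⟨w, fun y hy => hw0 y (Finset.mem_filter.1 hy).1, ?_, ?_⟩
    · rw [← hw1]
      refine Finset.sum_filter_of_ne fun y hy => hz' y hy
    · rw [← hwx]
      refine Finset.sum_filter_of_ne fun y hy hne => hz' y hy fun h0 => hne ?_
      rw [h0, zero_smul]
  · exact fun x hx => ⟨convexHull_mono (fun y hy => hy.1) hx,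
      eq_of_mem_convexHull (fun y hy => hy.2) hx⟩

/-- Every nonempty exposed face is cut out by a supporting hyperplane. -/
theorem IsPolyFace.exists_eq {P F : Set E} (hF : IsPolyFace P F) (hne : F.Nonempty) :
    ∃ (l : E →L[ℝ] ℝ) (c : ℝ), (∀ x ∈ P, l x ≤ c) ∧ F = {x ∈ P | l x = c} := by
  obtain ⟨l, hl⟩ := hF hne
  obtain ⟨x₀, hx₀⟩ := hne
  have hx₀' := hx₀
  rw [hl] at hx₀'
  refine ⟨l, l x₀, hx₀'.2, ?_⟩
  rw [hl]
  ext x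
  exact ⟨fun hx => ⟨hx.1, le_antisymm (hx₀'.2 x hx.1) (hx.2 x₀ hx₀'.1)⟩,
    fun hx => ⟨hx.1, fun y hy => hx.2 ▸ hx₀'.2 y hy⟩⟩

theorem isPolyFace_setOf_eq {P : Set E} {l : E →L[ℝ] ℝ} {c : ℝ} (h : ∀ x ∈ P, l x ≤ c) :
    IsPolyFace P {x ∈ P | l x = c} := by
  rintro ⟨x₀, hx₀, rfl⟩
  refine ⟨l, ?_⟩
  ext x
  exact ⟨fun hx => ⟨hx.1, fun y hy => hx.2 ▸ h y hy⟩,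
    fun hx => ⟨hx.1, le_antisymm (h x hx.1) (hx.2 x₀ hx₀)⟩⟩

variable [FiniteDimensional ℝ E]

/-- Affine functionals take arbitrary values on affinely independent points. -/
theorem AffineIndependent.exists_continuousLinearMap {ι : Type*} {p : ι → E}
    (hp : AffineIndependent ℝ p) (i₀ : ι) (f : ι → ℝ) :
    ∃ l : E →L[ℝ] ℝ, ∀ i, l (p i) - l (p i₀) = f i - f i₀ := by
  rw [affineIndependent_iff_linearIndependent_vsub ℝ p i₀] at hp
  let g := (Module.Basis.span hp).constr ℝ (fun i : {x // x ≠ i₀} => f i - f i₀)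
  obtain ⟨l, hl⟩ := LinearMap.exists_extend g
  refine ⟨LinearMap.toContinuousLinearMap l, fun i => ?_⟩
  by_cases hi : i = i₀
  · simp [hi]
  · have h1 : g (Module.Basis.span hp ⟨i, hi⟩) = f i - f i₀ := by
      simp only [g, Module.Basis.constr_basis]
    rw [← hl] at h1
    have h2 : ((Module.Basis.span hp ⟨i, hi⟩ : _) : E) = p i -ᵥ p i₀ := by
      rw [Module.Basis.span_apply]
    rw [LinearMap.comp_apply, Submodule.subtype_apply, h2, vsub_eq_sub, map_sub] at h1
    exact h1

/-- On affinely independent points a functional may be prescribed, up to a constant, as 0 on `G` and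
-1 elsewhere; so every nonempty set of vertices of a simplex spans a face. -/
theorem AffineIndependent.exists_supporting {X : Set E}
    (hX : AffineIndependent ℝ ((↑) : X → E)) {G : Set E} (hG : G ⊆ X) (hne : G.Nonempty) :
    ∃ (l : E →L[ℝ] ℝ) (c : ℝ), (∀ x ∈ G, l x = c) ∧ ∀ x ∈ X, x ∉ G → l x < c := by
  classical
  obtain ⟨x₀, hx₀⟩ := hne
  obtain ⟨l, hl⟩ := hX.exists_continuousLinearMap ⟨x₀, hG hx₀⟩ (fun i => if (i : E) ∈ G then 0 else -1)
  refine ⟨l, l x₀, fun x hx => ?_, fun x hx hxG => ?_⟩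
  · have := hl ⟨x, hG hx⟩
    simp only [hx, hx₀, if_true] at this
    linarith
  · have := hl ⟨x, hx⟩
    simp only [hxG, hx₀, if_true, if_false] at this
    linarith

omit [FiniteDimensional ℝ E] in
/-- A face of a face is a face, for the vertex sets. -/
theorem exists_supporting_of_face {V : Finset E} {l l' : E →L[ℝ] ℝ} {c c' : ℝ} {G : Set E}
    (hl : ∀ x ∈ V, l x ≤ c) (hGc : ∀ x ∈ G, l x = c) (hG : ∀ x ∈ G, l' x = c')
    (hl' : ∀ x ∈ V, l x = c → x ∉ G → l' x < c') :
    ∃ (m : E →L[ℝ] ℝ) (e : ℝ), (∀ x ∈ G, m x = e) ∧ ∀ x ∈ V, x ∉ G → m x < e := by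
  -- For large `M`, `M * l + l'` works: off the first face the gap in `l` dominates, and on it `l'`
  -- decides.
  have hev : ∀ x ∈ V, ∀ᶠ M : ℝ in Filter.atTop, x ∉ G → M * l x + l' x < M * c + c' := by
    intro x hx
    by_cases hxc : l x = c
    · filter_upwards with M hxG
      rw [hxc]
      linarith [hl' x hx hxc hxG]
    · have hpos : 0 < c - l x := sub_pos.2 (lt_of_le_of_ne (hl x hx) hxc)
      filter_upwards [Filter.eventually_gt_atTop ((l' x - c') / (c - l x))] with M hM _
      rw [div_lt_iff₀ hpos] at hM
      linarith
  obtain ⟨M, hM⟩ := ((Filter.eventually_all_finset V).2 hev).exists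
  refine ⟨M • l + l', M * c + c', fun x hx => ?_, fun x hx hxG => ?_⟩
  · simp [hGc x hx, hG x hx]
  · simpa using hM x hx hxG

theorem AffineIndependent.extremePoints_convexHull {X : Finset E}
    (hX : AffineIndependent ℝ ((↑) : ↥(X : Set E) → E)) :
    (convexHull ℝ (X : Set E)).extremePoints ℝ = X := by
  refine Set.Subset.antisymm extremePoints_convexHull_subset fun x hx => ?_
  obtain ⟨l, c, h1, h2⟩ := hX.exists_supporting (Set.singleton_subset_iff.2 hx)
    (Set.singleton_nonempty x)
  have hc : ∀ y ∈ X, l y ≤ c := fun y hy => by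
    by_cases hyx : y = x
    · exact (h1 y hyx).le
    · exact (h2 y hy hyx).le
  have heq := convexHull_inter_hyperplane hc
  have hs : {y | y ∈ X ∧ l y = c} = {x} := by
    ext y
    refine ⟨fun hy => by_contra fun hne => (h2 y hy.1 hne).ne hy.2, ?_⟩
    rintro rfl
    exact ⟨hx, h1 y rfl⟩
  rw [hs, convexHull_singleton] at heq
  have := isPolyFace_setOf_eq (P := convexHull ℝ (X : Set E)) (l := l) (c := c)
    (fun y hy => le_of_mem_convexHull hc hy)
  rw [heq] at this
  exact isExtreme_singleton.1 this.isExtreme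

omit [FiniteDimensional ℝ E] in
theorem IsGeomSimplex.exists_finset {d : ℕ} {P : Set E} (h : IsGeomSimplex d P) :
    ∃ X : Finset E, AffineIndependent ℝ ((↑) : ↥(X : Set E) → E) ∧ X.card = d + 1 ∧
      P = convexHull ℝ (X : Set E) := by
  obtain ⟨s, rfl⟩ := h
  refine ⟨Finset.univ.map ⟨s.points, s.independent.injective⟩, ?_, by simp, by simp⟩
  have : ((Finset.univ.map ⟨s.points, s.independent.injective⟩ : Finset E) : Set E) =
      Set.range s.points := by simp
  rw [this]
  exact s.independent.range

omit [FiniteDimensional ℝ E] in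
theorem isGeomSimplex_convexHull {X : Finset E}
    (hX : AffineIndependent ℝ ((↑) : ↥(X : Set E) → E)) {m : ℕ} (hm : X.card = m + 1) :
    IsGeomSimplex m (convexHull ℝ (X : Set E)) := by
  let e : Fin (m + 1) ≃ X := (X.equivFinOfCardEq hm).symm
  refine ⟨⟨fun i => (e i : E), hX.comp_embedding e.toEmbedding⟩, ?_⟩
  congr 1
  ext x
  constructor
  · intro hx
    exact ⟨e.symm ⟨x, hx⟩, by simp⟩
  · rintro ⟨i, rfl⟩
    exact (e i).2

omit [FiniteDimensional ℝ E] in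
theorem polyDim_convexHull (X : Set E) :
    polyDim (convexHull ℝ X) = Module.finrank ℝ (vectorSpan ℝ X) := by
  rw [polyDim, ← direction_affineSpan, affineSpan_convexHull, direction_affineSpan]

omit [FiniteDimensional ℝ E] in
theorem polyDim_of_affineIndependent {X : Finset E}
    (hX : AffineIndependent ℝ ((↑) : ↥(X : Set E) → E)) (hne : X.Nonempty) :
    polyDim (convexHull ℝ (X : Set E)) + 1 = X.card := by
  have hc : Fintype.card (X : Set E) = (X.card - 1) + 1 := by
    have := Finset.card_pos.2 hne
    simp
    omega
  have := hX.finrank_vectorSpan hc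
  rw [polyDim_convexHull]
  rw [Subtype.range_coe] at this
  have := Finset.card_pos.2 hne
  omega

omit [FiniteDimensional ℝ E] in
theorem IsGeomSimplex.isSimplicialPolytope {d : ℕ} {P : Set E} (h : IsGeomSimplex d P) :
    IsSimplicialPolytope d P := by
  classical
  obtain ⟨X, hX, hXd, rfl⟩ := h.exists_finset
  have hne : X.Nonempty := Finset.card_pos.1 (by omega)
  refine ⟨⟨X, rfl⟩, ?_, ?_, ?_⟩
  · rw [convexHull_nonempty_iff]
    exact_mod_cast hne
  · have := polyDim_of_affineIndependent hX hne
    omega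
  · intro F hF hFne _
    obtain ⟨l, c, hl, rfl⟩ := hF.exists_eq hFne
    have hle : ∀ x ∈ X, l x ≤ c := fun x hx => hl x (subset_convexHull ℝ _ hx)
    rw [convexHull_inter_hyperplane hle] at hFne ⊢
    rw [convexHull_nonempty_iff] at hFne
    have hcoe : {x | x ∈ X ∧ l x = c} = ((X.filter (fun x => l x = c) : Finset E) : Set E) := by
      ext; simp
    rw [hcoe] at hFne ⊢
    have hpos := Finset.card_pos.2 (by exact_mod_cast hFne)
    refine ⟨(X.filter (fun x => l x = c)).card - 1, isGeomSimplex_convexHull ?_ (by omega)⟩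
    exact hX.mono fun x hx => (Finset.mem_filter.1 hx).1

omit [FiniteDimensional ℝ E] in
-- This is Krein–Milman; the closure is superfluous because there are finitely many extreme points.
theorem IsPolytope.convexHull_polyVertices {P : Set E} (h : IsPolytope P) :
    (polyVertices P).Finite ∧ convexHull ℝ (polyVertices P) = P := by
  obtain ⟨S, rfl⟩ := h
  have hfin : (polyVertices (convexHull ℝ (S : Set E))).Finite :=
    S.finite_toSet.subset extremePoints_convexHull_subset
  refine ⟨hfin, ?_⟩
  have := closure_convexHull_extremePoints (S.finite_toSet.isCompact_convexHull (𝕜 := ℝ))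
    (convex_convexHull ℝ (S : Set E))
  rw [← (hfin.isClosed_convexHull (𝕜 := ℝ)).closure_eq]
  exact this

end Geometry

/-! ### From the boundary complex to the edge graph -/

section SimplicialPolytope

variable {E : Type*} [NormedAddCommGroup E] [NormedSpace ℝ E] [FiniteDimensional ℝ E]
  {d : ℕ} {P : Set E} {V : Finset E}

omit [FiniteDimensional ℝ E] in
theorem IsSimplicialPolytope.convexHull_eq (hP : IsSimplicialPolytope d P)
    (hV : (V : Set E) = polyVertices P) : convexHull ℝ (V : Set E) = P := by
  rw [hV, hP.isPolytope.convexHull_polyVertices.2]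

omit [FiniteDimensional ℝ E] in
theorem mem_of_mem_convexHull_of_subset (hV : (V : Set E) = polyVertices P) {F : Set E}
    (hF : convexHull ℝ F ⊆ P) {x : E} (hx : x ∈ V) (hxF : x ∈ convexHull ℝ F) : x ∈ F := by
  have hx' : x ∈ P.extremePoints ℝ := hV.le (show x ∈ (V : Set E) from hx)
  exact extremePoints_convexHull_subset (𝕜 := ℝ) (inter_extremePoints_subset_extremePoints_of_subset hF ⟨hxF, hx'⟩)

omit [FiniteDimensional ℝ E] in
/-- In a simplicial polytope the vertices on a supporting hyperplane are affinely independent. -/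
theorem IsSimplicialPolytope.affineIndependent (hP : IsSimplicialPolytope d P)
    (hV : (V : Set E) = polyVertices P) {l : E →L[ℝ] ℝ} {c : ℝ} (hl : ∀ x ∈ V, l x ≤ c)
    (hne : ∃ x ∈ V, l x = c) (hproper : ∃ x ∈ V, l x < c) :
    AffineIndependent ℝ ((↑) : {x | x ∈ V ∧ l x = c} → E) := by
  have hPV := hP.convexHull_eq hV
  have hVP : ∀ x ∈ V, x ∈ P := fun x hx => hPV ▸ subset_convexHull ℝ _ hx
  have hlP : ∀ x ∈ P, l x ≤ c := fun x hx => by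
    rw [← hPV] at hx
    exact le_of_mem_convexHull hl hx
  obtain ⟨x₀, hx₀, hx₀c⟩ := hne
  obtain ⟨m, hm⟩ := hP.face_simplex _ (isPolyFace_setOf_eq hlP) ⟨x₀, hVP x₀ hx₀, hx₀c⟩ (by
    obtain ⟨y, hy, hyc⟩ := hproper
    intro h
    have := hVP y hy
    rw [← h] at this
    exact hyc.ne this.2)
  obtain ⟨X, hX, -, hXe⟩ := hm.exists_finset
  refine hX.mono fun x hx => ?_
  refine mem_of_mem_convexHull_of_subset hV (hXe ▸ fun y hy => hy.1) hx.1 ?_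
  rw [← hXe]
  exact ⟨hVP x hx.1, hx.2⟩

/-- Two vertices of a simplicial polytope on a common proper face form an edge. -/
theorem IsSimplicialPolytope.isEdge (hP : IsSimplicialPolytope d P)
    (hV : (V : Set E) = polyVertices P) {l : E →L[ℝ] ℝ} {c : ℝ} (hl : ∀ x ∈ V, l x ≤ c)
    (hproper : ∃ x ∈ V, l x < c) {a b : E} (ha : a ∈ V) (hb : b ∈ V) (hab : a ≠ b)
    (hac : l a = c) (hbc : l b = c) : IsEdge V a b := by
  have hX := hP.affineIndependent hV hl ⟨a, ha, hac⟩ hproper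
  obtain ⟨l', c', h1, h2⟩ := hX.exists_supporting (G := {a, b})
    (by rintro x (rfl | rfl); exacts [⟨ha, hac⟩, ⟨hb, hbc⟩]) ⟨a, Or.inl rfl⟩
  obtain ⟨m, e, h3, h4⟩ := exists_supporting_of_face (G := {a, b}) hl
    (by rintro x (rfl | rfl); exacts [hac, hbc]) h1 (fun x hx hxc => h2 x ⟨hx, hxc⟩)
  have hma := h3 a (Or.inl rfl)
  refine ⟨hab, m, hma.trans (h3 b (Or.inr rfl)).symm, fun x hx hxa hxb => ?_⟩
  rw [hma]
  exact h4 x hx (by rintro (h | h); exacts [hxa h, hxb h])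

/-- A pair in the restriction may come from a larger face `F`, but it is then an edge because that
face is a simplex. Conversely `3 ≤ V.card` ensures `{a, b} ≠ V`. -/
theorem IsSimplicialPolytope.pair_mem_restrictComplex_iff (hP : IsSimplicialPolytope d P)
    (hV : (V : Set E) = polyVertices P) (hcard : 3 ≤ V.card) {W : Finset E} (hW : W ⊆ V)
    {a b : E} (hab : a ≠ b) :
    ({a, b} : Set E) ∈ restrictComplex (boundaryComplex P) (W : Set E) ↔
      a ∈ W ∧ b ∈ W ∧ IsEdge V a b := by
  classical
  have hPV := hP.convexHull_eq hV
  constructor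
  · rintro ⟨F, ⟨hFV, hFne, hF⟩, heq⟩
    rw [← hV] at hFV hFne
    have ha : a ∈ F ∩ W := heq ▸ Or.inl rfl
    have hb : b ∈ F ∩ W := heq ▸ Or.inr rfl
    refine ⟨ha.2, hb.2, ?_⟩
    obtain ⟨l, c, hl, hFe⟩ := hF.exists_eq ⟨a, subset_convexHull ℝ _ ha.1⟩
    have hFP : convexHull ℝ F ⊆ P := hFe ▸ fun x hx => hx.1
    have hlF : ∀ x ∈ F, l x = c := fun x hx => by
      have := subset_convexHull ℝ F hx
      rw [hFe] at this
      exact this.2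
    have hVP : ∀ x ∈ V, x ∈ P := fun x hx => hPV ▸ subset_convexHull ℝ _ hx
    refine hP.isEdge hV (fun x hx => hl x (hVP x hx)) ?_ (hW ha.2) (hW hb.2) hab
      (hlF a ha.1) (hlF b hb.1)
    -- If all vertices lay on the hyperplane, they would all belong to `F`, against `F ≠ V`.
    by_contra! hc
    refine hFne (hFV.antisymm fun x hx => ?_)
    refine mem_of_mem_convexHull_of_subset hV hFP hx ?_
    rw [hFe]
    exact ⟨hVP x hx, le_antisymm (hl x (hVP x hx)) (hc x hx)⟩
  · rintro ⟨ha, hb, -, l, hlab, hl⟩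
    have hle : ∀ x ∈ V, l x ≤ l a := fun x hx => by
      by_cases hxa : x = a
      · rw [hxa]
      by_cases hxb : x = b
      · rw [hxb, hlab]
      exact (hl x hx hxa hxb).le
    have hsub : ({a, b} : Set E) ⊆ V := by rintro x (rfl | rfl); exacts [hW ha, hW hb]
    refine ⟨{a, b}, ⟨hV ▸ hsub, ?_, ?_⟩, ?_⟩
    · rw [← hV]
      intro h
      have : V = {a, b} := by
        apply Finset.coe_injective
        rw [← h]
        simp
      have h2 := Finset.card_le_two (a := a) (b := b)
      rw [← this] at h2
      omega
    · have heq : {x | x ∈ V ∧ l x = l a} = {a, b} := by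
        ext x
        constructor
        · rintro ⟨hx, hxl⟩
          by_contra hc
          simp only [Set.mem_insert_iff, Set.mem_singleton_iff, not_or] at hc
          exact (hl x hx hc.1 hc.2).ne hxl
        · rintro (rfl | rfl)
          exacts [⟨hW ha, rfl⟩, ⟨hW hb, hlab.symm⟩]
      rw [← heq, ← convexHull_inter_hyperplane hle, hPV]
      exact isPolyFace_setOf_eq fun x hx => by
        rw [← hPV] at hx
        exact le_of_mem_convexHull hle hx
    · refine (Set.inter_eq_left.2 ?_).symm
      rintro x (rfl | rfl)
      exacts [ha, hb]

theorem IsSimplicialPolytope.specialBetti_eq (hP : IsSimplicialPolytope d P)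
    (hV : (V : Set E) = polyVertices P) (hcard : 3 ≤ V.card) (k : ℕ) :
    specialBetti (boundaryComplex P) V k = graphBetti (IsEdge V) V k := by
  refine Finset.sum_congr rfl fun W hW => ?_
  rw [numComponents_eq_componentCount (R := IsEdge V) IsEdge.symm]
  exact fun a b hab => hP.pair_mem_restrictComplex_iff hV hcard (Finset.mem_powersetCard.1 hW).1 hab

end SimplicialPolytope

/-! ### Edges before and after attaching a simplex -/

section Attachment

variable {E : Type*} [NormedAddCommGroup E] [NormedSpace ℝ E]

/-- The configuration of vertices arising from attaching a simplex with apex `v` to the facet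
with vertex set `F` of the `d`-polytope with vertex set `V`. -/
structure IsApex (d : ℕ) (V F : Finset E) (v : E) : Prop where
  notMem : v ∉ V
  subset : F ⊆ V
  card_eq : F.card = d
  affineIndependent : AffineIndependent ℝ ((↑) : ↥(F : Set E) → E)
  supporting : ∃ (f : E →L[ℝ] ℝ) (c : ℝ), (∀ x ∈ F, f x = c) ∧ ∀ x ∈ V, x ∉ F → f x < c
  exists_notMem : ∃ x ∈ V, x ∉ F
  -- This retains what is needed from the convexity of the union.
  segment : ∀ x ∈ V, x ∉ F →
    ∃ s : ℝ, 0 < s ∧ s < 1 ∧ (1 - s) • x + s • v ∈ convexHull ℝ (F : Set E)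

/-- The segment is connected and covered by two closed sets that both meet it, so they meet on it.
-/
theorem Convex.exists_mem_segment_inter {P S : Set E} (hP : IsClosed P) (hS : IsClosed S)
    (hconv : Convex ℝ (P ∪ S)) {x v : E} (hx : x ∈ P) (hv : v ∈ S) :
    ∃ s : ℝ, 0 ≤ s ∧ s ≤ 1 ∧ (1 - s) • x + s • v ∈ P ∩ S := by
  have hseg : segment ℝ x v ⊆ P ∪ S := hconv.segment_subset (Or.inl hx) (Or.inr hv)
  obtain ⟨y, hy, hyPS⟩ := isPreconnected_closed_iff.1 (convex_segment x v).isPreconnected P S hP hS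
    hseg ⟨x, left_mem_segment ℝ x v, hx⟩ ⟨v, right_mem_segment ℝ x v, hv⟩
  rw [segment_eq_image] at hy
  obtain ⟨s, hs, rfl⟩ := hy
  exact ⟨s, hs.1, hs.2, hyPS⟩

theorem IsPolytope.isClosed {P : Set E} (hP : IsPolytope P) : IsClosed P := by
  obtain ⟨S, rfl⟩ := hP
  exact S.finite_toSet.isClosed_convexHull (𝕜 := ℝ)

theorem IsPolytope.convex {P : Set E} (hP : IsPolytope P) : Convex ℝ P := by
  obtain ⟨S, rfl⟩ := hP
  exact convex_convexHull ℝ _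

variable [FiniteDimensional ℝ E]

open Classical in
theorem IsAttachment.exists_isApex {d : ℕ} {P Q : Set E} (hP : IsSimplicialPolytope d P)
    (hPQ : IsAttachment d P Q) {V : Finset E} (hV : (V : Set E) = polyVertices P) :
    ∃ (F : Finset E) (v : E), IsApex d V F v ∧ ((insert v V : Finset E) : Set E) = polyVertices Q := by
  obtain ⟨S, F₀, hS, ⟨hFP, hFne, hFdim⟩, ⟨hFS, -, -⟩, hinter, rfl, hQ, hvert⟩ := hPQ
  obtain ⟨U, hU, hUcard, hSU⟩ := hS.exists_finset
  have hSext : polyVertices S = U := by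
    rw [hSU]
    exact hU.extremePoints_convexHull
  have hF₁ : F₀.extremePoints ℝ = F₀ ∩ V := by
    rw [hV]
    exact hFP.isExtreme.extremePoints_eq
  have hF₂ : F₀.extremePoints ℝ = F₀ ∩ U := by
    rw [← hSext]
    exact hFS.isExtreme.extremePoints_eq
  have hUS : ∀ x ∈ U, x ∈ S := fun x hx => hSU ▸ subset_convexHull ℝ _ hx
  have hVP : ∀ x ∈ V, x ∈ P := fun x hx => hP.convexHull_eq hV ▸ subset_convexHull ℝ _ hx
  obtain ⟨F, hFU, hFF₀, hconv⟩ : ∃ F : Finset E, F ⊆ U ∧ (∀ x ∈ U, x ∈ F ↔ x ∈ F₀) ∧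
      F₀ = convexHull ℝ (F : Set E) := by
    obtain ⟨l, c, hl, hFe⟩ := hFS.exists_eq hFne
    refine ⟨U.filter (fun x => l x = c), Finset.filter_subset _ _, fun x hx => ?_, ?_⟩
    · rw [hFe, Finset.mem_filter]
      exact ⟨fun h => ⟨hUS x hx, h.2⟩, fun h => ⟨hx, h.2⟩⟩
    · have := convexHull_inter_hyperplane (V := U) (l := l) (c := c) fun x hx => hl x (hUS x hx)
      rw [← hSU] at this
      rw [hFe, this]
      congr 1
      ext; simp
  -- The extreme points of the common facet are the vertices of `P` in it and equally those of `S`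
  -- in it.
  have hFV : ∀ x, x ∈ F ↔ x ∈ F₀ ∧ x ∈ V := fun x => by
    have h1 : x ∈ F₀ ∩ (V : Set E) ↔ x ∈ F₀ ∩ (U : Set E) := by rw [← hF₁, hF₂]
    constructor
    · exact fun h => h1.2 ⟨(hFF₀ x (hFU h)).1 h, hFU h⟩
    · intro h
      have := h1.1 h
      exact (hFF₀ x this.2).2 this.1
  have hFind : AffineIndependent ℝ ((↑) : ↥(F : Set E) → E) := hU.mono fun x hx => hFU hx
  have hFne' : F.Nonempty := by
    rw [hconv, convexHull_nonempty_iff] at hFne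
    exact_mod_cast hFne
  have hFcard : F.card = d := by
    rw [← hFdim, hconv, polyDim_of_affineIndependent hFind hFne']
  obtain ⟨v, hv⟩ := Finset.card_eq_one.1 (show (U \ F).card = 1 by
    rw [Finset.card_sdiff_of_subset hFU, hUcard, hFcard]; omega)
  have hvU : v ∈ U ∧ v ∉ F := Finset.mem_sdiff.1 (hv ▸ Finset.mem_singleton_self v)
  have hvF₀ : v ∉ F₀ := fun h => hvU.2 ((hFF₀ v hvU.1).2 h)
  have hUeq : ∀ x ∈ U, x = v ∨ x ∈ F := fun x hx => by
    by_cases hxF : x ∈ F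
    · exact Or.inr hxF
    · exact Or.inl (Finset.mem_singleton.1 (hv ▸ Finset.mem_sdiff.2 ⟨hx, hxF⟩))
  refine ⟨F, v, ⟨?_, fun x hx => ((hFV x).1 hx).2, hFcard, hFind, ?_, ?_, ?_⟩, ?_⟩
  · exact fun h => hvF₀ (hinter ▸ ⟨hVP v h, hUS v hvU.1⟩)
  · obtain ⟨f, c, hf, hFe⟩ := hFP.exists_eq hFne
    refine ⟨f, c, fun x hx => ?_, fun x hx hxF => lt_of_le_of_ne (hf x (hVP x hx)) fun h => hxF ?_⟩
    · have := ((hFV x).1 hx).1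
      rw [hFe] at this
      exact this.2
    · rw [hFV, hFe]
      exact ⟨⟨hVP x hx, h⟩, hx⟩
  · by_contra! hc
    have hVF : V = F := Finset.Subset.antisymm hc fun x hx => ((hFV x).1 hx).2
    have h1 := hP.dim_eq
    rw [← hP.convexHull_eq hV, hVF, ← hconv] at h1
    omega
  · intro x hx hxF
    have hxF₀ : x ∉ F₀ := fun h => hxF ((hFV x).2 ⟨h, hx⟩)
    obtain ⟨s, hs0, hs1, hs⟩ := Convex.exists_mem_segment_inter hP.isPolytope.isClosed
      (IsPolytope.isClosed ⟨U, hSU⟩) hQ.isPolytope.convex (hVP x hx) (hUS v hvU.1)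
    rw [hinter] at hs
    refine ⟨s, lt_of_le_of_ne hs0 ?_, lt_of_le_of_ne hs1 ?_, hconv ▸ hs⟩
    · rintro rfl
      simp only [sub_zero, one_smul, zero_smul, add_zero] at hs
      exact hxF₀ hs
    · rintro rfl
      simp only [sub_self, one_smul, zero_smul, zero_add] at hs
      exact hvF₀ hs
  · rw [hvert, hSext, ← hV]
    ext x
    simp only [Finset.coe_insert, Set.mem_insert_iff, Set.mem_union, Finset.mem_coe]
    constructor
    · rintro (rfl | h)
      exacts [Or.inr hvU.1, Or.inl h]
    · rintro (h | h)
      · exact Or.inr h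
      · exact (hUeq x h).imp id fun hx => ((hFV x).1 hx).2

variable {d : ℕ} {V F : Finset E} {v : E} {P Q : Set E}

theorem IsApex.isEdge_base (h : IsApex d V F v) (hP : IsSimplicialPolytope d P)
    (hV : (V : Set E) = polyVertices P) {a b : E} (ha : a ∈ F) (hb : b ∈ F) (hab : a ≠ b) :
    IsEdge V a b := by
  obtain ⟨f, c, h1, h2⟩ := h.supporting
  obtain ⟨x, hx, hxF⟩ := h.exists_notMem
  refine hP.isEdge hV (fun y hy => ?_) ⟨x, hx, h2 x hx hxF⟩ (h.subset ha) (h.subset hb) hab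
    (h1 a ha) (h1 b hb)
  by_cases hyF : y ∈ F
  · exact (h1 y hyF).le
  · exact (h2 y hy hyF).le

variable [DecidableEq E]

omit [FiniteDimensional ℝ E] in
theorem IsEdge.of_insert {a b : E} (h : IsEdge (insert v V) a b) : IsEdge V a b := by
  obtain ⟨hab, l, hl, h⟩ := h
  exact ⟨hab, l, hl, fun x hx => h x (Finset.mem_insert_of_mem hx)⟩

omit [FiniteDimensional ℝ E] in
-- If `a` were outside `F`, the functional exposing the edge would be constant on the segment from
-- `a` to `v`, yet strictly smaller at its crossing point with conv `F`.
theorem IsApex.mem_of_isEdge (h : IsApex d V F v) {a : E} (ha : a ∈ V)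
    (hav : IsEdge (insert v V) a v) : a ∈ F := by
  by_contra haF
  obtain ⟨s, hs0, hs1, hs⟩ := h.segment a ha haF
  obtain ⟨-, l, hl, hlt⟩ := hav
  have hF : ∀ x ∈ F, l x < l a := fun x hx => hlt x (Finset.mem_insert_of_mem (h.subset hx))
    (fun he => haF (he ▸ hx)) (fun he => h.notMem (he ▸ h.subset hx))
  have hconv : Convex ℝ {x | l x < l a} := convex_halfSpace_lt l.toLinearMap.isLinear _
  have : l ((1 - s) • a + s • v) < l a := convexHull_min (fun x hx => hF x hx) hconv hs
  simp only [map_add, map_smul, smul_eq_mul, ← hl] at this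
  linarith

/-- The functional exposing the edge in `V` is at most `l a` at the crossing point of the segment
from `a` to `v`, hence also at `v`. Equality at `v` is harmless since `Q` is simplicial. -/
theorem IsApex.isEdge_of_notMem (h : IsApex d V F v) (hQ : IsSimplicialPolytope d Q)
    (hV : ((insert v V : Finset E) : Set E) = polyVertices Q) (hcard : 3 ≤ V.card) {a b : E}
    (ha : a ∈ V) (hb : b ∈ V) (haF : a ∉ F) (hab : IsEdge V a b) : IsEdge (insert v V) a b := by
  obtain ⟨hne, l, hl, hlt⟩ := hab
  have hle : ∀ x ∈ V, l x ≤ l a := fun x hx => by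
    by_cases hxa : x = a
    · rw [hxa]
    by_cases hxb : x = b
    · rw [hxb, hl]
    exact (hlt x hx hxa hxb).le
  obtain ⟨s, hs0, hs1, hs⟩ := h.segment a ha haF
  have hy := le_of_mem_convexHull (fun x hx => hle x (h.subset hx)) hs
  simp only [map_add, map_smul, smul_eq_mul] at hy
  have hv : l v ≤ l a := by
    have : s * l v ≤ s * l a := by linarith
    exact le_of_mul_le_mul_left this hs0
  obtain ⟨x, hx, hxab⟩ : ∃ x ∈ V, x ∉ ({a, b} : Finset E) := by
    by_contra! hc
    have := (Finset.card_le_card hc).trans Finset.card_le_two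
    omega
  simp only [Finset.mem_insert, Finset.mem_singleton, not_or] at hxab
  refine hQ.isEdge hV (c := l a) (fun y hy => ?_)
    ⟨x, Finset.mem_insert_of_mem hx, hlt x hx hxab.1 hxab.2⟩
    (Finset.mem_insert_of_mem ha) (Finset.mem_insert_of_mem hb) hne rfl hl.symm
  rcases Finset.mem_insert.1 hy with rfl | hy
  · exact hv
  · exact hle y hy

/-- A proper face of the base together with the apex lies on a supporting hyperplane. -/
theorem IsApex.isEdge_of_mem (h : IsApex d V F v) (hQ : IsSimplicialPolytope d Q)
    (hV : ((insert v V : Finset E) : Set E) = polyVertices Q) (hd : 2 ≤ d) {a b w : E}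
    (hw : w ∈ F) (ha : a ∈ insert v F) (hb : b ∈ insert v F) (hab : a ≠ b) (haw : a ≠ w)
    (hbw : b ≠ w) : IsEdge (insert v V) a b := by
  obtain ⟨f, c, hfF, hfV⟩ := h.supporting
  have hne : (F.erase w).Nonempty := by
    rw [← Finset.card_pos, Finset.card_erase_of_mem hw, h.card_eq]
    omega
  obtain ⟨g, e, hg, hgw⟩ := h.affineIndependent.exists_supporting (G := (F.erase w : Finset E))
    (by exact_mod_cast Finset.erase_subset w F) (by exact_mod_cast hne)
  have hgw' : g w < e := hgw w hw (by simp)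
  have hg' : ∀ x ∈ F, x ≠ w → g x = e := fun x hx hxw => hg x (by simp [hx, hxw])
  -- At the crossing point `f` equals `c`, while `f x < c`, so `f v = c` is impossible.
  have hfv : f v - c ≠ 0 := by
    obtain ⟨x, hx, hxF⟩ := h.exists_notMem
    obtain ⟨s, hs0, hs1, hs⟩ := h.segment x hx hxF
    have h1 := eq_of_mem_convexHull hfF hs
    simp only [map_add, map_smul, smul_eq_mul] at h1
    have h2 := hfV x hx hxF
    intro h0
    have h3 : f v = c := by linarith
    rw [h3] at h1
    have : (1 - s) * (c - f x) = 0 := by linarith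
    rcases mul_eq_zero.1 this with h4 | h4 <;> linarith
  -- Since `f` is constant on `F`, subtracting a multiple of it only shifts `g` there; `t` is tuned
  -- so that `v` gets the same value as `F.erase w`.
  set t := (g v - e) / (f v - c) with ht
  have hval : ∀ x, (g - t • f) x = g x - t * f x := fun x => by simp
  have hv : (g - t • f) v = e - t * c := by
    have : t * (f v - c) = g v - e := div_mul_cancel₀ _ hfv
    rw [hval]
    linarith
  have hF : ∀ x ∈ F, x ≠ w → (g - t • f) x = e - t * c := fun x hx hxw => by
    rw [hval, hg' x hx hxw, hfF x hx]
  have hlw : (g - t • f) w < e - t * c := by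
    rw [hval, hfF w hw]
    linarith
  have hFle : ∀ x ∈ F, (g - t • f) x ≤ e - t * c := fun x hx => by
    by_cases hxw : x = w
    · rw [hxw]; exact hlw.le
    · exact (hF x hx hxw).le
  generalize g - t • f = l at hv hF hlw hFle
  generalize e - t * c = c' at hv hF hlw hFle
  have key : ∀ x ∈ insert v F, x ≠ w → l x = c' ∧ x ∈ insert v V := fun x hx hxw => by
    rcases Finset.mem_insert.1 hx with rfl | hx
    · exact ⟨hv, Finset.mem_insert_self _ _⟩
    · exact ⟨hF x hx hxw, Finset.mem_insert_of_mem (h.subset hx)⟩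
  refine hQ.isEdge hV (l := l) (c := c') (fun x hx => ?_)
    ⟨w, Finset.mem_insert_of_mem (h.subset hw), hlw⟩
    (key a ha haw).2 (key b hb hbw).2 hab (key a ha haw).1 (key b hb hbw).1
  rcases Finset.mem_insert.1 hx with rfl | hx
  · exact hv.le
  by_cases hxF : x ∈ F
  · exact hFle x hxF
  · obtain ⟨s, hs0, hs1, hs⟩ := h.segment x hx hxF
    have h1 := le_of_mem_convexHull hFle hs
    simp only [map_add, map_smul, smul_eq_mul, hv] at h1
    have : (1 - s) * l x ≤ (1 - s) * c' := by linarith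
    exact le_of_mul_le_mul_left this (by linarith)

omit [FiniteDimensional ℝ E] in
-- The hypotheses force `F = {a, b}`. The functional would be constant on conv `F`, yet a point of
-- it is a proper convex combination of `x` and `v`, where the functional is smaller.
theorem IsApex.not_isEdge_of_subset (h : IsApex d V F v) {a b : E}
    (hF : ∀ x ∈ F, x = a ∨ x = b) (ha : a ∈ F) (hb : b ∈ F) : ¬ IsEdge (insert v V) a b := by
  rintro ⟨-, l, hl, hlt⟩
  obtain ⟨x, hx, hxF⟩ := h.exists_notMem
  obtain ⟨s, hs0, hs1, hs⟩ := h.segment x hx hxF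
  have h1 : ∀ y ∈ F, l y = l a := fun y hy => by
    rcases hF y hy with rfl | rfl
    exacts [rfl, hl.symm]
  have h2 := eq_of_mem_convexHull h1 hs
  simp only [map_add, map_smul, smul_eq_mul] at h2
  have h3 := hlt x (Finset.mem_insert_of_mem hx) (fun he => hxF (he ▸ ha)) (fun he => hxF (he ▸ hb))
  have h4 := hlt v (Finset.mem_insert_self _ _) (fun he => h.notMem (he ▸ h.subset ha))
    (fun he => h.notMem (he ▸ h.subset hb))
  have h5 := mul_lt_mul_of_pos_left h3 (show 0 < 1 - s by linarith)
  have h6 := mul_lt_mul_of_pos_left h4 hs0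
  linarith

theorem IsApex.isEdge_apex_iff (h : IsApex d V F v) (hQ : IsSimplicialPolytope d Q)
    (hV : ((insert v V : Finset E) : Set E) = polyVertices Q) (hd : 2 ≤ d) {a : E} (ha : a ∈ V) :
    IsEdge (insert v V) a v ↔ a ∈ F := by
  refine ⟨h.mem_of_isEdge ha, fun haF => ?_⟩
  obtain ⟨w, hw, hwa⟩ := Finset.exists_mem_ne (by rw [h.card_eq]; omega : 1 < F.card) a
  exact h.isEdge_of_mem hQ hV hd hw (Finset.mem_insert_of_mem haF) (Finset.mem_insert_self _ _)
    (fun he => h.notMem (he ▸ ha)) hwa.symm (fun he => h.notMem (he ▸ h.subset hw))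

/-- For two vertices of `F`, the condition `d ≥ 3` provides a third vertex `w`, and the pair
survives on the new face spanned by `v` and `F.erase w`. -/
theorem IsApex.isEdge_insert_iff (h : IsApex d V F v) (hQ : IsSimplicialPolytope d Q)
    (hV : ((insert v V : Finset E) : Set E) = polyVertices Q) (hd : 3 ≤ d) {a b : E} (ha : a ∈ V)
    (hb : b ∈ V) : IsEdge (insert v V) a b ↔ IsEdge V a b := by
  refine ⟨fun hab => hab.of_insert, fun hab => ?_⟩
  have hcard : 3 ≤ V.card := hd.trans (h.card_eq ▸ Finset.card_le_card h.subset)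
  by_cases haF : a ∈ F
  · by_cases hbF : b ∈ F
    · obtain ⟨w, hw, hwab⟩ : ∃ x ∈ F, x ∉ ({a, b} : Finset E) := by
        by_contra! hc
        have h1 := (Finset.card_le_card hc).trans Finset.card_le_two
        have h2 := h.card_eq
        omega
      simp only [Finset.mem_insert, Finset.mem_singleton, not_or] at hwab
      exact h.isEdge_of_mem hQ hV (by omega) hw (Finset.mem_insert_of_mem haF)
        (Finset.mem_insert_of_mem hbF) hab.1 (Ne.symm hwab.1) (Ne.symm hwab.2)
    · exact (h.isEdge_of_notMem hQ hV hcard hb ha hbF hab.symm).symm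
  · exact h.isEdge_of_notMem hQ hV hcard ha hb haF hab

end Attachment

/-! ### Induction over stacked polytopes -/

section Stacked

variable {E : Type*} [NormedAddCommGroup E] [NormedSpace ℝ E] [FiniteDimensional ℝ E]
  {d : ℕ} {P : Set E}

omit [FiniteDimensional ℝ E] in
theorem IsStackedPolytope.isSimplicialPolytope (hP : IsStackedPolytope d P) :
    IsSimplicialPolytope d P := by
  cases hP with
  | simplex _ h => exact h.isSimplicialPolytope
  | attach _ _ _ h =>
    obtain ⟨_, _, _, _, _, _, _, hQ, _⟩ := h
    exact hQ

theorem IsGeomSimplex.isEdge (hP : IsGeomSimplex d P) {V : Finset E}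
    (hV : (V : Set E) = polyVertices P) :
    V.card = d + 1 ∧ ∀ a ∈ V, ∀ b ∈ V, a ≠ b → IsEdge V a b := by
  obtain ⟨X, hX, hXd, rfl⟩ := hP.exists_finset
  have hVX : V = X := Finset.coe_injective (hV.trans hX.extremePoints_convexHull)
  subst hVX
  refine ⟨hXd, fun a ha b hb hab => ?_⟩
  obtain ⟨l, c, h1, h2⟩ := hX.exists_supporting (G := {a, b})
    (by rintro x (rfl | rfl); exacts [ha, hb]) ⟨a, Or.inl rfl⟩
  have hla := h1 a (Or.inl rfl)
  refine ⟨hab, l, hla.trans (h1 b (Or.inr rfl)).symm, fun x hx hxa hxb => ?_⟩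
  rw [hla]
  exact h2 x hx (by rintro (h | h); exacts [hxa h, hxb h])

theorem IsStackedPolytope.graphBetti_eq (hd : 3 ≤ d) (hP : IsStackedPolytope d P) :
    ∀ V : Finset E, (V : Set E) = polyVertices P → d + 1 ≤ V.card ∧
      ∀ k : ℕ, graphBetti (IsEdge V) V k = ((k : ℤ) - 1) * ((V.card - d).choose k : ℤ) := by
  classical
  induction hP with
  | simplex P hP =>
    intro V hV
    obtain ⟨hcard, hedge⟩ := hP.isEdge hV
    refine ⟨hcard.ge, fun k => ?_⟩
    -- The target is now (k-1)C(1, k): it is -1 at `k = 0`, and for `k ≥ 1` either the factor or the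
    -- binomial vanishes.
    rw [hcard, Nat.add_sub_cancel_left]
    match k with
    | 0 => simp
    | k + 1 =>
      have h0 : graphBetti (IsEdge V) V (k + 1) = 0 := by
        refine Finset.sum_eq_zero fun W hW => ?_
        obtain ⟨hWV, hWc⟩ := Finset.mem_powersetCard.1 hW
        rw [componentCount_of_clique IsEdge.symm (Finset.card_pos.1 (by omega))
          fun x hx y hy => hedge x (hWV hx) y (hWV hy)]
        simp
      rw [h0]
      cases k with
      | zero => simp
      | succ k => simp [Nat.choose_eq_zero_of_lt (show 1 < k + 1 + 1 by omega)]
  | attach P Q hPs hPQ ih =>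
    intro V' hV'
    have hP := hPs.isSimplicialPolytope
    have hQ := (hPs.attach P Q hPQ).isSimplicialPolytope
    obtain ⟨V, hV⟩ := hP.isPolytope.convexHull_polyVertices.1.exists_finset_coe
    obtain ⟨F, v, hA, hins⟩ := hPQ.exists_isApex hP hV
    obtain rfl : V' = insert v V := Finset.coe_injective (hV'.trans hins.symm)
    obtain ⟨hcard, hb⟩ := ih V hV
    rw [Finset.card_insert_of_notMem hA.notMem]
    refine ⟨by omega, fun k => ?_⟩
    cases k with
    | zero => simp
    | succ k =>
      have hVV : ∀ x ∈ V, ∀ y ∈ V, IsEdge (insert v V) x y ↔ IsEdge V x y :=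
        fun x hx y hy => hA.isEdge_insert_iff hQ hins hd hx hy
      rw [graphBetti_insert IsEdge.symm hA.notMem hA.subset
        (fun x hx y hy hxy => (hVV x (hA.subset hx) y (hA.subset hy)).2
          (hA.isEdge_base hP hV hx hy hxy))
        (fun x hx => hA.isEdge_apex_iff hQ hins (by omega) hx),
        graphBetti_congr hVV, graphBetti_congr hVV, hb, hb, hA.card_eq,
        show V.card + 1 - d = V.card - d + 1 by omega, Nat.choose_succ_succ]
      push_cast
      ring

theorem isCycleGraph_of_card_eq_three {α : Type*} {R : α → α → Prop} (hirr : ∀ x, ¬ R x x)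
    {V : Finset α} (hV : V.card = 3) (h : ∀ a ∈ V, ∀ b ∈ V, a ≠ b → R a b) :
    ∃ σ, IsCycleGraph R V σ := by
  classical
  obtain ⟨a, b, c, hab, hac, hbc, rfl⟩ := Finset.card_eq_three.1 hV
  set σ : α → α := fun x => if x = a then b else if x = b then c else a with hσ
  have ha : σ a = b := by simp [hσ]
  have hb : σ b = c := by simp [hσ, hab.symm]
  have hc : σ c = a := by simp [hσ, hac.symm, hbc.symm]
  have hR : ∀ x ∈ ({a, b, c} : Finset α), ∀ y ∈ ({a, b, c} : Finset α), R x y ↔ x ≠ y :=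
    fun x hx y hy => ⟨fun hxy he => hirr y (he ▸ hxy), h x hx y hy⟩
  refine ⟨σ, ?_, ?_, ?_, ?_, ?_⟩
  · simp [ha, hb, hc]
  · simp [ha, hb, hc, hac, hab.symm, hbc.symm]
  · simp [ha, hb, hc, hab, hbc, hac.symm]
  · intro x hx y hy
    rw [hR x hx y hy]
    simp only [Finset.mem_insert, Finset.mem_singleton] at hx hy
    rcases hx with rfl | rfl | rfl <;> rcases hy with rfl | rfl | rfl <;>
      simp [ha, hb, hc, hab, hac, hbc, hab.symm, hac.symm, hbc.symm]
  · intro A hA hne hcl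
    have h1 : a ∈ A → b ∈ A := fun hx => ha ▸ hcl a hx
    have h2 : b ∈ A → c ∈ A := fun hx => hb ▸ hcl b hx
    have h3 : c ∈ A → a ∈ A := fun hx => hc ▸ hcl c hx
    have haA : a ∈ A := by
      obtain ⟨x, hx⟩ := hne
      have := hA hx
      simp only [Finset.coe_insert, Finset.coe_singleton, Set.mem_insert_iff,
        Set.mem_singleton_iff] at this
      rcases this with rfl | rfl | rfl
      exacts [hx, h3 (h2 hx), h3 hx]
    refine hA.antisymm ?_
    intro x hx
    simp only [Finset.coe_insert, Finset.coe_singleton, Set.mem_insert_iff,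
      Set.mem_singleton_iff] at hx
    rcases hx with rfl | rfl | rfl
    exacts [haA, h1 haA, h2 (h1 haA)]

/-- Attaching a triangle removes exactly the edge `F` and joins `v` to its two ends, so the boundary
cycle is subdivided once. -/
theorem IsStackedPolytope.exists_isCycleGraph (hP : IsStackedPolytope d P) (hd : d = 2) :
    ∀ V : Finset E, (V : Set E) = polyVertices P →
      3 ≤ V.card ∧ ∃ σ, IsCycleGraph (IsEdge V) V σ := by
  classical
  subst hd
  have hirr : ∀ (V : Finset E) (x : E), ¬ IsEdge V x x := fun V x h => h.1 rfl
  induction hP with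
  | simplex P hP =>
    intro V hV
    obtain ⟨hcard, hedge⟩ := hP.isEdge hV
    exact ⟨hcard.ge, isCycleGraph_of_card_eq_three (hirr V) hcard hedge⟩
  | attach P Q hPs hPQ ih =>
    intro V' hV'
    have hP := hPs.isSimplicialPolytope
    have hQ := (hPs.attach P Q hPQ).isSimplicialPolytope
    obtain ⟨V, hV⟩ := hP.isPolytope.convexHull_polyVertices.1.exists_finset_coe
    obtain ⟨F, v, hA, hins⟩ := hPQ.exists_isApex hP hV
    obtain rfl : V' = insert v V := Finset.coe_injective (hV'.trans hins.symm)
    obtain ⟨hcard, σ, hσ⟩ := ih V hV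
    refine ⟨by rw [Finset.card_insert_of_notMem hA.notMem]; omega, ?_⟩
    -- The base is an edge of `P`, so its ends are consecutive on the cycle; `a` is the one that
    -- comes first.
    obtain ⟨a, ha, hF⟩ : ∃ a ∈ V, F = {a, σ a} := by
      obtain ⟨a, b, hab, rfl⟩ := Finset.card_eq_two.1 hA.card_eq
      have haF : a ∈ ({a, b} : Finset E) := by simp
      have hbF : b ∈ ({a, b} : Finset E) := by simp
      have hedge := hA.isEdge_base hP hV haF hbF hab
      rcases (hσ.adj_iff a (hA.subset haF) b (hA.subset hbF)).1 hedge with h | h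
      · exact ⟨a, hA.subset haF, by rw [h]⟩
      · exact ⟨b, hA.subset hbF, by rw [h, Finset.pair_comm]⟩
    have haF : a ∈ F := by simp [hF]
    have hbF : σ a ∈ F := by simp [hF]
    have hFab : ∀ x ∈ F, x = a ∨ x = σ a := fun x hx => by simpa [hF] using hx
    have hnot := hA.not_isEdge_of_subset hFab haF hbF
    refine ⟨_, hσ.insert_vertex IsEdge.symm (hirr _) ha hA.notMem (fun x hx y hy => ?_)
      fun x hx => ?_⟩
    · constructor
      · refine fun h => ⟨h.of_insert, ?_, ?_⟩
        · rintro ⟨rfl, rfl⟩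
          exact hnot h
        · rintro ⟨rfl, rfl⟩
          exact hnot h.symm
      · rintro ⟨h, h1, h2⟩
        by_cases hxF : x ∈ F
        · by_cases hyF : y ∈ F
          · exfalso
            rcases hFab x hxF with hx' | hx' <;> rcases hFab y hyF with hy' | hy'
            exacts [h.1 (hx'.trans hy'.symm), h1 ⟨hx', hy'⟩, h2 ⟨hx', hy'⟩, h.1 (hx'.trans hy'.symm)]
          · exact (hA.isEdge_of_notMem hQ hins hcard hy hx hyF h.symm).symm
        · exact hA.isEdge_of_notMem hQ hins hcard hx hy hxF h
    · rw [hA.isEdge_apex_iff hQ hins le_rfl hx, hF]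
      simp

end Stacked

theorem mainTheorem1 {E : Type*} [NormedAddCommGroup E] [NormedSpace ℝ E]
    [FiniteDimensional ℝ E] (d n k : ℕ) (P : Set E) (hP : IsStackedPolytope d P)
    (V : Finset E) (hV : (V : Set E) = polyVertices P) (hn : V.card = n) :
    (3 ≤ d →
      specialBetti (boundaryComplex P) V k = ((k : ℤ) - 1) * ((n - d).choose k : ℤ)) ∧
    (d = 2 →
      (k = n → specialBetti (boundaryComplex P) V k = 0) ∧
      (k ≠ n → (specialBetti (boundaryComplex P) V k : ℚ) =
        (n : ℚ) * ((k : ℚ) - 1) / ((n : ℚ) - (k : ℚ)) * ((n - 2).choose k : ℚ))) := by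
  subst hn
  have hS := hP.isSimplicialPolytope
  constructor
  · intro hd
    obtain ⟨hcard, hb⟩ := hP.graphBetti_eq hd V hV
    -- The bound `d + 1 ≤ V.card` supplies the three vertices needed to pass to the graph.
    rw [hS.specialBetti_eq hV (by omega), hb]
  · intro hd
    obtain ⟨hcard, σ, hσ⟩ := hP.exists_isCycleGraph hd V hV
    rw [hS.specialBetti_eq hV hcard]
    exact hσ.graphBetti_eq IsEdge.symm (by omega) k
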